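/- Let $V_0$ be a simple Euclidean Jordan algebra, that is, a finite-dimensional real commutative algebra satisfying the Jordan identity $x(x^2y)=x^2(xy)$, whose bilinear form $\beta(x,y)=\operatorname{Tr}L(xy)$, with $L(x)y=xy$, is positive definite, and whose only ideals are $0$ and $V_0\neq 0$; it has an identity element $e$. Let $n=\dim V_0$, let the rank $r$ be the largest degree of the minimal polynomial of an element of $V_0$, and call $x$ regular if its minimal polynomial $f_x$ has degree $r$. Let $\Delta$ be the Jordan determinant, i.e. the polynomial function on $V_0$ such that $(-1)^r\Delta(x)$ is the constant coefficient of $f_x$ for regular $x$. Let $\Omega=\{x^2 : x\in V_0 \text{ invertible}\}$ be the symmetric cone and $T_\Omega=V_0+i\Omega\subset V_0\otimes_{\mathbb R}\mathbb C$ the corresponding tube domain. For $\nu\in\mathbb R$ let $H^2_\nu(T_\Omega)$ be the weighted Bergman space of all holomorphic functions $F:T_\Omega\to\mathbb C$ with $$\|F\|_\nu^2=\int_{T_\Omega}|F(x+iy)|^2\,\Delta(y)^{\nu-2n/r}\,dx\,dy<\infty .$$ Let $\nu_1,\nu_2>\frac{2n}{r}-1$ be real numbers, $F_1\in H^2_{\nu_1}(T_\Omega)$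 and $F_2\in H^2_{\nu_2}(T_\Omega)$. Then the pointwise product $F_1F_2$ belongs to $H^2_{\nu_1+\nu_2}(T_\Omega)$. -/

import Mathlib

open scoped TensorProduct
open Polynomial MeasureTheory

noncomputable section

namespace EJA

section Algebra

variable (V : Type*) [NonUnitalNonAssocCommRing V] [Module ℝ V]
  [IsScalarTower ℝ V V] [SMulCommClass ℝ V V]

variable {V} in
/-- The multiplication operator `L(x) : y ↦ x * y`. -/
def mulL (x : V) : V →ₗ[ℝ] V := LinearMap.mul ℝ V x

/-- The bilinear form `β(x, y) = Tr L(x * y)`. -/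
def traceForm : LinearMap.BilinForm ℝ V :=
  (LinearMap.mul ℝ V).compr₂ ((LinearMap.trace ℝ V).comp (LinearMap.mul ℝ V))

/-- A Euclidean Jordan algebra: a finite-dimensional real commutative algebra satisfying the
Jordan identity, whose form `β(x, y) = Tr L(x * y)` is positive definite. -/
class EuclideanJordanAlgebra : Prop extends IsCommJordan V where
  finiteDimensional : FiniteDimensional ℝ V
  traceForm_pos : ∀ x : V, x ≠ 0 → 0 < traceForm V x x

attribute [instance] EuclideanJordanAlgebra.finiteDimensional

variable {V}

theorem mulL_apply (x y : V) : mulL x y = x * y := rfl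

theorem traceForm_apply (x y : V) :
    traceForm V x y = LinearMap.trace ℝ V (mulL (x * y)) := rfl

theorem traceForm_comm (x y : V) : traceForm V x y = traceForm V y x := by
  rw [traceForm_apply, traceForm_apply, mul_comm]

variable [EuclideanJordanAlgebra V]

theorem jordan_linearized (a b d w : V) :
    a * (d * (b * w)) + b * (d * (a * w)) + a * b * d * w
      = a * d * (b * w) + b * d * (a * w) + a * b * (d * w) := by
  have h := DFunLike.congr_fun (two_nsmul_lie_lmul_lmul_add_add_eq_zero a b w) d
  have h2 : (2 : ℝ) • (a * (b * w * d) - b * w * (a * d) + (b * (w * a * d) - w * a * (b * d))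
      + (w * (a * b * d) - a * b * (w * d))) = 0 := by
    rw [ofNat_smul_eq_nsmul]; exact h
  have h3 := (smul_eq_zero.1 h2).resolve_left two_ne_zero
  rw [mul_comm (b * w) d, mul_comm w a, mul_comm (a * w) d, mul_comm w (a * b * d),
    mul_comm w d, mul_comm (b * w) (a * d), mul_comm (a * w) (b * d)] at h3
  rw [← sub_eq_zero, ← h3]
  abel

/-- The trace form is associative. -/
theorem traceForm_assoc (x y z : V) : traceForm V (x * y) z = traceForm V x (y * z) := by
  have key : ∀ a b d : V, mulL (a * b * d)
      = mulL (a * d) * mulL b + mulL (b * d) * mulL a + mulL (a * b) * mulL d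
        - mulL a * mulL d * mulL b - mulL b * mulL d * mulL a := by
    intro a b d
    ext w
    simp only [LinearMap.add_apply, LinearMap.sub_apply, Module.End.mul_apply, mulL_apply]
    rw [← jordan_linearized a b d w]
    abel
  have t : ∀ a b : V →ₗ[ℝ] V, LinearMap.trace ℝ V (a * b) = LinearMap.trace ℝ V (b * a) :=
    LinearMap.trace_mul_comm ℝ
  rw [traceForm_apply, traceForm_apply, mul_comm x (y * z), key x y z, key y z x]
  simp only [map_add, map_sub]
  rw [mul_comm y x, mul_comm z x, t (mulL x * mulL z) (mulL y),
    t (mulL y * mulL z) (mulL x), ← mul_assoc, ← mul_assoc, t (mulL x * mulL y) (mulL z),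
    ← mul_assoc]
  ring

theorem traceForm_nondegenerate : (traceForm V).Nondegenerate := by
  refine LinearMap.IsRefl.nondegenerate_iff_separatingLeft ?_ |>.2 ?_
  · intro x y h; rw [traceForm_comm, h]
  · intro x h
    by_contra hx
    exact (EuclideanJordanAlgebra.traceForm_pos x hx).ne' (h x)

/-- A Euclidean Jordan algebra has an identity element. -/
theorem exists_unit : ∃ e : V, ∀ x : V, e * x = x := by
  let f : Module.Dual ℝ V := (LinearMap.trace ℝ V).comp (LinearMap.mul ℝ V)
  let e := ((traceForm V).toDual traceForm_nondegenerate).symm f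
  have he : ∀ y, traceForm V e y = LinearMap.trace ℝ V (mulL y) := fun y =>
    LinearMap.BilinForm.apply_toDual_symm_apply (hB := traceForm_nondegenerate) f y
  refine ⟨e, fun x => ?_⟩
  have hw : ∀ u, traceForm V (e * x - x) u = 0 := fun u => by
    rw [map_sub, LinearMap.sub_apply, traceForm_assoc, he, traceForm_apply, sub_self]
  exact sub_eq_zero.1 (traceForm_nondegenerate.1 _ hw)

variable (V) in
/-- The identity element `e`. -/
def unit : V := (exists_unit (V := V)).choose

theorem unit_mul (x : V) : unit V * x = x := (exists_unit (V := V)).choose_spec x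

/-- The value `p(x)` of a real polynomial at `x`, where `x ^ 0 = e` and
`x ^ (k + 1) = x * x ^ k`, that is, `x ^ k = L(x) ^ k e`. -/
def evalAt (x : V) (p : ℝ[X]) : V := aeval (mulL x) p (unit V)

/-- The ideal of all real polynomials that vanish at `x`. -/
def annIdeal (x : V) : Ideal ℝ[X] where
  carrier := {p | evalAt x p = 0}
  zero_mem' := by simp [evalAt]
  add_mem' {p q} hp hq := by
    simp only [Set.mem_ofPred_eq, evalAt] at hp hq ⊢
    simp [hp, hq]
  smul_mem' c p hp := by
    simp only [Set.mem_ofPred_eq, evalAt] at hp ⊢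
    simp [Module.End.mul_apply, hp]

/-- The minimal polynomial `f_x` of `x`: the monic generator of the annihilating ideal. -/
def minPoly (x : V) : ℝ[X] := normalize (Submodule.IsPrincipal.generator (annIdeal x))

variable (V) in
/-- The rank `r`: the largest degree of a minimal polynomial. -/
def rank : ℕ := ⨆ x : V, (minPoly x).natDegree

/-- `x` is regular if its minimal polynomial has the largest possible degree `r`. -/
def IsRegular (x : V) : Prop := (minPoly x).natDegree = rank V

/-- `x` is invertible if `x * y = e` for some `y` in the subalgebra `ℝ[x]` of polynomials
in `x`. -/
def IsInvertible (x : V) : Prop := ∃ p : ℝ[X], x * evalAt x p = unit V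

variable (V) in
/-- The symmetric cone `Ω = {x² | x invertible}`. -/
def cone : Set V := {y | ∃ x : V, IsInvertible x ∧ y = x * x}

variable (V) in
/-- The positive definite form `β` as an inner product. -/
@[reducible] def innerCore : InnerProductSpace.Core ℝ V where
  inner x y := traceForm V x y
  conj_inner_symm x y := by simp [traceForm_comm x y]
  re_inner_nonneg x := by
    rcases eq_or_ne x 0 with rfl | hx
    · simp
    · simpa using (EuclideanJordanAlgebra.traceForm_pos x hx).le
  add_left x y z := by simp
  smul_left x y r := by simp
  definite x hx := by
    by_contra h
    exact (EuclideanJordanAlgebra.traceForm_pos x h).ne' hx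

/-- A Euclidean Jordan algebra is a Euclidean vector space under the inner product `β`; this
fixes its topology and its Lebesgue measure `volume`. -/
instance (priority := 50) instNormedAddCommGroup : NormedAddCommGroup V :=
  (innerCore V).toNormedAddCommGroup

instance (priority := 50) instInnerProductSpace : InnerProductSpace ℝ V :=
  InnerProductSpace.ofCore (innerCore V).toCore

/-- The Jordan determinant `Δ`. At a regular `x`, where
`f_x(λ) = λ ^ r - a₁(x) λ ^ (r - 1) + ⋯ + (-1) ^ r a_r(x)`, it is `a_r(x)`; it is extended by
continuity from the dense set of regular elements to the whole algebra. -/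
def jdet : V → ℝ := extendFrom {x | IsRegular x} fun x => (-1) ^ rank V * (minPoly x).coeff 0

variable (V) in
/-- The tube domain `T_Ω = V + iΩ` in the complexification `ℂ ⊗ V`. -/
def tube : Set (ℂ ⊗[ℝ] V) := {z | ∃ x : V, ∃ y ∈ cone V, z = 1 ⊗ₜ[ℝ] x + Complex.I ⊗ₜ[ℝ] y}

/-- The square norm
`‖F‖_ν² = ∫_{T_Ω} |F(x + iy)|² Δ(y) ^ (ν - 2n/r) dx dy`, with values in `[0, ∞]`. -/
def bergmanNormSq [MeasurableSpace V] [BorelSpace V] (ν : ℝ) (F : ℂ ⊗[ℝ] V → ℂ) : ENNReal :=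
  ∫⁻ p in (Set.univ : Set V) ×ˢ cone V,
    ENNReal.ofReal (‖F (1 ⊗ₜ[ℝ] p.1 + Complex.I ⊗ₜ[ℝ] p.2)‖ ^ 2 *
      jdet p.2 ^ (ν - 2 * (Module.finrank ℝ V : ℝ) / (rank V : ℝ)))
    ∂((volume : Measure V).prod (volume : Measure V))

/-- `F` (restricted to `T_Ω`) belongs to the weighted Bergman space `H²_ν(T_Ω)`. -/
def MemBergman [MeasurableSpace V] [BorelSpace V] (ν : ℝ) (F : ℂ ⊗[ℝ] V → ℂ) : Prop :=
  DifferentiableOn ℂ F (tube V) ∧ bergmanNormSq ν F < ⊤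

end Algebra

end EJA

end

/-!
The proof is the pointwise estimate `|F(x + iy)|² Δ(y) ^ ν ≤ C ‖F‖_ν²` on the tube: since
`Δ(y) ^ (ν₁ + ν₂ - 2n/r) = Δ(y) ^ ν₁ Δ(y) ^ (ν₂ - 2n/r)`, applying it to one factor and
integrating the other bounds the norm of the product.

At `ie` the estimate is the mean value inequality on a balanced neighbourhood. Every `y` in the
cone is `exp(L(h)) e` for some `h`, and `exp(L(h))` acts on the tube, so the same neighbourhood can
be transported to `x + iy`. What has to be checked is how volume and `Δ` transform: the quadratic
representation `P` satisfies `P(exp(L(h)) w) = exp(L(h)) P(w) exp(L(h))` (both sides solve the same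
linear differential equation), and `Det P(y) = Δ(y) ^ (2n/r)` by the spectral theorem, because all
primitive idempotents of a simple algebra have the same trace `n/r`.
-/

namespace EJA

/-! ### Power associativity -/

section

variable {V : Type*} [NonUnitalNonAssocCommRing V] [Module ℝ V]
  [IsScalarTower ℝ V V] [SMulCommClass ℝ V V]

theorem mulL_zero : mulL (0 : V) = 0 := map_zero (LinearMap.mul ℝ V)

theorem mulL_add (x y : V) : mulL (x + y) = mulL x + mulL y := map_add (LinearMap.mul ℝ V) x y

theorem mulL_smul (a : ℝ) (x : V) : mulL (a • x) = a • mulL x := map_smul (LinearMap.mul ℝ V) a x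

theorem mulL_sum {ι : Type*} (s : Finset ι) (f : ι → V) :
    mulL (∑ i ∈ s, f i) = ∑ i ∈ s, mulL (f i) := map_sum (LinearMap.mul ℝ V) f s

theorem aeval_mulL_apply_of_mul_eq_smul {x v : V} {a : ℝ} (h : x * v = a • v) (p : ℝ[X]) :
    aeval (mulL x) p v = p.eval a • v :=
  Module.End.aeval_apply_of_mem_apply_eq_smul h

theorem trace_mulL_of_idempotent {c : V} (hc : c * c = c) :
    LinearMap.trace ℝ V (mulL c) = traceForm V c c := by
  rw [traceForm_apply, hc]

end

variable {V : Type*} [NonUnitalNonAssocCommRing V] [Module ℝ V]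
  [IsScalarTower ℝ V V] [SMulCommClass ℝ V V] [EuclideanJordanAlgebra V]

theorem mul_unit (x : V) : x * unit V = x := by rw [mul_comm, unit_mul]

theorem mulL_unit : mulL (unit V) = 1 := LinearMap.ext unit_mul

theorem mulL_mul_mul (a b d : V) : mulL (a * b * d)
    = mulL (a * d) * mulL b + mulL (b * d) * mulL a + mulL (a * b) * mulL d
      - mulL a * mulL d * mulL b - mulL b * mulL d * mulL a := by
  ext w
  simp only [LinearMap.add_apply, LinearMap.sub_apply, Module.End.mul_apply, mulL_apply]
  rw [← jordan_linearized a b d w]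
  abel

theorem traceForm_mul_left (x y z : V) : traceForm V (x * y) z = traceForm V y (x * z) := by
  rw [mul_comm x y, traceForm_assoc]

theorem isSymmetric_mulL (x : V) : (mulL x).IsSymmetric := traceForm_mul_left x

theorem traceForm_self_nonneg (x : V) : 0 ≤ traceForm V x x := by
  rcases eq_or_ne x 0 with rfl | hx
  · simp
  · exact (EuclideanJordanAlgebra.traceForm_pos x hx).le

theorem eq_zero_of_traceForm_self_eq_zero {x : V} (h : traceForm V x x = 0) : x = 0 := by
  by_contra hx
  exact (EuclideanJordanAlgebra.traceForm_pos x hx).ne' h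

theorem evalAt_add (x : V) (p q : ℝ[X]) : evalAt x (p + q) = evalAt x p + evalAt x q := by
  simp [evalAt]

theorem evalAt_sub (x : V) (p q : ℝ[X]) : evalAt x (p - q) = evalAt x p - evalAt x q := by
  simp [evalAt]

theorem evalAt_sum (x : V) {ι : Type*} (s : Finset ι) (p : ι → ℝ[X]) :
    evalAt x (∑ i ∈ s, p i) = ∑ i ∈ s, evalAt x (p i) := by
  simp [evalAt]

theorem evalAt_C_mul (x : V) (a : ℝ) (p : ℝ[X]) : evalAt x (C a * p) = a • evalAt x p := by
  simp [evalAt, Module.End.mul_apply, Module.algebraMap_end_apply]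

theorem evalAt_X_pow (x : V) (k : ℕ) : evalAt x (X ^ k) = (mulL x ^ k) (unit V) := by
  simp [evalAt]

theorem evalAt_zero (x : V) : evalAt x 0 = 0 := by
  simp [evalAt]

theorem evalAt_one (x : V) : evalAt x 1 = unit V := by
  simp [evalAt]

theorem evalAt_X (x : V) : evalAt x X = x := by
  simp [evalAt, mulL_apply, mul_unit]

theorem evalAt_X_pow_succ (x : V) (k : ℕ) : evalAt x (X ^ (k + 1)) = evalAt x (X ^ k) * x := by
  rw [evalAt_X_pow, evalAt_X_pow, pow_succ', Module.End.mul_apply, mulL_apply, mul_comm]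

theorem commute_mulL_mul_self (x : V) : Commute (mulL x) (mulL (x * x)) := by
  ext w
  simp only [Module.End.mul_apply, mulL_apply]
  rw [mul_comm (x * x) w, ← IsCommJordan.lmul_comm_rmul_rmul x w, mul_comm]

theorem commute_mulL_evalAt_X_pow (x : V) (k : ℕ) :
    Commute (mulL x) (mulL (evalAt x (X ^ k))) := by
  induction k using Nat.twoStepInduction with
  | zero => simp [evalAt_one, mulL_unit]
  | one => simp [evalAt_X]
  | more k ih ih_succ =>
    rw [evalAt_X_pow_succ] at ih_succ
    have hx := Commute.refl (mulL x)
    rw [evalAt_X_pow_succ, evalAt_X_pow_succ, mulL_mul_mul]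
    exact ((((ih_succ.mul_right hx).add_right ((commute_mulL_mul_self x).mul_right ih)).add_right
      (ih_succ.mul_right hx)).sub_right ((ih.mul_right hx).mul_right hx)).sub_right
      ((hx.mul_right hx).mul_right ih)

theorem commute_mulL_evalAt (x : V) (p : ℝ[X]) : Commute (mulL x) (mulL (evalAt x p)) := by
  induction p using Polynomial.induction_on' with
  | add p q hp hq => rw [evalAt_add, mulL_add]; exact hp.add_right hq
  | monomial k a =>
    rw [← C_mul_X_pow_eq_monomial, evalAt_C_mul, mulL_smul]
    exact (commute_mulL_evalAt_X_pow x k).smul_right a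

theorem evalAt_mul (x : V) (p q : ℝ[X]) : evalAt x (p * q) = evalAt x p * evalAt x q := by
  have h : Commute (mulL (evalAt x p)) (aeval (mulL x) q) :=
    Algebra.commute_of_mem_adjoin_singleton_of_commute (aeval_mem_adjoin_singleton ℝ _)
      (commute_mulL_evalAt x p).symm
  calc evalAt x (p * q) = aeval (mulL x) q (evalAt x p) := by
        rw [mul_comm, evalAt, map_mul, Module.End.mul_apply, evalAt]
    _ = aeval (mulL x) q (mulL (evalAt x p) (unit V)) := by rw [mulL_apply, mul_unit]
    _ = evalAt x p * evalAt x q := (LinearMap.congr_fun h.eq (unit V)).symm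

/-! ### Minimal polynomials and the spectral theorem -/

theorem evalAt_eq_zero_iff_minPoly_dvd {x : V} {p : ℝ[X]} : evalAt x p = 0 ↔ minPoly x ∣ p := by
  rw [minPoly, normalize_dvd_iff, ← Submodule.IsPrincipal.mem_iff_generator_dvd]
  rfl

theorem minPoly_dvd_charpoly (x : V) : minPoly x ∣ (mulL x).charpoly :=
  evalAt_eq_zero_iff_minPoly_dvd.1 (by rw [evalAt, LinearMap.aeval_self_charpoly]; rfl)

theorem natDegree_minPoly_le_finrank (x : V) : (minPoly x).natDegree ≤ Module.finrank ℝ V :=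
  (natDegree_le_of_dvd (minPoly_dvd_charpoly x) (mulL x).charpoly_monic.ne_zero).trans_eq
    (mulL x).charpoly_natDegree

theorem monic_minPoly (x : V) : (minPoly x).Monic := by
  refine Polynomial.monic_normalize fun h => (mulL x).charpoly_monic.ne_zero ?_
  have := minPoly_dvd_charpoly x
  rwa [minPoly, h, normalize_zero, zero_dvd_iff] at this

theorem bddAbove_natDegree_minPoly : BddAbove (Set.range fun x : V => (minPoly x).natDegree) :=
  ⟨Module.finrank ℝ V, Set.forall_mem_range.2 natDegree_minPoly_le_finrank⟩

theorem natDegree_minPoly_le_rank (x : V) : (minPoly x).natDegree ≤ rank V :=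
  le_ciSup bddAbove_natDegree_minPoly x

variable (V) in
theorem exists_isRegular : ∃ x : V, IsRegular x :=
  Set.mem_range.1 (Nat.sSup_mem (Set.range_nonempty _) bddAbove_natDegree_minPoly)

theorem exists_minPoly_dvd_prod (x : V) : ∃ s : Finset ℝ, minPoly x ∣ ∏ a ∈ s, (X - C a) := by
  let b := (isSymmetric_mulL x).eigenvectorBasis rfl
  let ev := (isSymmetric_mulL x).eigenvalues rfl
  refine ⟨Finset.univ.image ev, evalAt_eq_zero_iff_minPoly_dvd.1 ?_⟩
  suffices h : aeval (mulL x) (∏ a ∈ Finset.univ.image ev, (X - C a)) = 0 by rw [evalAt, h]; rfl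
  refine b.toBasis.ext fun i => ?_
  have hb : x * b.toBasis i = ev i • b.toBasis i := by
    rw [OrthonormalBasis.coe_toBasis]
    exact (isSymmetric_mulL x).apply_eigenvectorBasis rfl i
  rw [aeval_mulL_apply_of_mul_eq_smul hb, LinearMap.zero_apply, eval_prod,
    Finset.prod_eq_zero (Finset.mem_image_of_mem ev (Finset.mem_univ i)) (by simp), zero_smul]

theorem exists_minPoly_eq_prod (x : V) : ∃ s : Finset ℝ, minPoly x = ∏ a ∈ s, (X - C a) := by
  obtain ⟨t, ht⟩ := exists_minPoly_dvd_prod x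
  have hsplits : (minPoly x).Splits :=
    (Splits.prod fun a _ => Splits.X_sub_C a).of_dvd
      (monic_prod_of_monic _ _ fun a _ => monic_X_sub_C a).ne_zero ht
  have hnodup : (minPoly x).roots.Nodup :=
    nodup_roots (((separable_prod_X_sub_C_iff' (f := fun a => a)).2
      fun _ _ _ _ h => h).of_dvd ht)
  refine ⟨⟨_, hnodup⟩, ?_⟩
  exact hsplits.eq_prod_roots_of_monic (monic_minPoly x)

theorem evalAt_eq_evalAt_iff {x : V} {s : Finset ℝ} (hs : minPoly x = ∏ a ∈ s, (X - C a))
    {p q : ℝ[X]} : evalAt x p = evalAt x q ↔ ∀ a ∈ s, p.eval a = q.eval a := by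
  rw [← sub_eq_zero, ← evalAt_sub, evalAt_eq_zero_iff_minPoly_dvd, hs]
  have root_iff : ∀ a, p.eval a = q.eval a ↔ X - C a ∣ p - q := fun a => by
    rw [dvd_iff_isRoot, IsRoot.def, eval_sub, sub_eq_zero]
  simp only [root_iff]
  refine ⟨fun h a ha => (Finset.dvd_prod_of_mem (X - C ·) ha).trans h, fun h => ?_⟩
  exact Finset.prod_dvd_of_coprime
    (fun a _ b _ hab => pairwise_coprime_X_sub_C Function.injective_id hab) h

/-- A complete system of nonzero orthogonal idempotents. -/
structure IsIdempotentSystem {ι : Type*} [Fintype ι] (c : ι → V) : Prop where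
  mul_self : ∀ i, c i * c i = c i
  mul_of_ne : ∀ i j, i ≠ j → c i * c j = 0
  ne_zero : ∀ i, c i ≠ 0
  sum_eq : ∑ i, c i = unit V

theorem exists_isIdempotentSystem (x : V) : ∃ (s : Finset ℝ) (c : s → V),
    IsIdempotentSystem c ∧ x = ∑ a : s, (a : ℝ) • c a := by
  classical
  obtain ⟨s, hs⟩ := exists_minPoly_eq_prod x
  have hinj : Function.Injective ((↑) : s → ℝ) := Subtype.val_injective
  let l : s → ℝ[X] := Lagrange.basis Finset.univ (↑)
  have hl : ∀ a b : s, (l a).eval ↑b = if a = b then 1 else 0 := fun a b => by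
    rcases eq_or_ne a b with rfl | hab
    · simp [l, Lagrange.eval_basis_self hinj.injOn]
    · simp [l, Lagrange.eval_basis_of_ne hab, hab]
  have key : ∀ p q : ℝ[X], evalAt x p = evalAt x q ↔ ∀ a : s, p.eval ↑a = q.eval ↑a :=
    fun p q => by rw [evalAt_eq_evalAt_iff hs, Subtype.forall]
  refine ⟨s, fun a => evalAt x (l a), ⟨fun a => ?_, fun a b hab => ?_, fun a h => ?_, ?_⟩, ?_⟩
  · rw [← evalAt_mul, key]
    simp [hl]
  · rw [← evalAt_mul, ← evalAt_zero x, key]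
    intro d
    rcases eq_or_ne a d with rfl | had
    · simp [hl, hab.symm]
    · simp [hl, had]
  · rw [← evalAt_zero x, key] at h
    simpa [hl] using h a
  · rw [← evalAt_sum, ← evalAt_one x, key]
    simp [eval_finsetSum, hl]
  · simp only [← evalAt_C_mul, ← evalAt_sum]
    conv_lhs => rw [← evalAt_X x]
    rw [key]
    simp [eval_finsetSum, hl]

namespace IsIdempotentSystem

variable {ι : Type*} [Fintype ι] {c : ι → V} (h : IsIdempotentSystem c)

include h

theorem sum_smul_mul (a : ι → ℝ) (j : ι) : (∑ i, a i • c i) * c j = a j • c j := by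
  rw [Finset.sum_mul, Fintype.sum_eq_single j, smul_mul_assoc, h.mul_self]
  intro i hij
  rw [smul_mul_assoc, h.mul_of_ne i j hij, smul_zero]

theorem sum_smul_mul_sum_smul (a b : ι → ℝ) :
    (∑ i, a i • c i) * (∑ i, b i • c i) = ∑ i, (a i * b i) • c i := by
  rw [Finset.mul_sum]
  refine Finset.sum_congr rfl fun i _ => ?_
  rw [mul_smul_comm, h.sum_smul_mul, smul_smul, mul_comm]

theorem sum_smul_inj {a b : ι → ℝ} : ∑ i, a i • c i = ∑ i, b i • c i ↔ a = b := by
  refine ⟨fun hab => funext fun i => ?_, fun hab => by rw [hab]⟩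
  have := congrArg (· * c i) hab
  simp only [h.sum_smul_mul] at this
  exact smul_left_injective ℝ (h.ne_zero i) this

theorem evalAt_sum_smul (a : ι → ℝ) (p : ℝ[X]) :
    evalAt (∑ i, a i • c i) p = ∑ i, p.eval (a i) • c i := by
  rw [evalAt, ← h.sum_eq, map_sum]
  exact Finset.sum_congr rfl fun i _ => aeval_mulL_apply_of_mul_eq_smul (h.sum_smul_mul a i) p

theorem minPoly_sum_smul {a : ι → ℝ} (ha : Function.Injective a) :
    minPoly (∑ i, a i • c i) = ∏ i, (X - C (a i)) := by
  have evalAt_eq_zero_iff : ∀ p, evalAt (∑ i, a i • c i) p = 0 ↔ ∀ i, X - C (a i) ∣ p := fun p => by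
    rw [h.evalAt_sum_smul, ← Fintype.sum_eq_zero (fun i => (0 : ℝ) • c i) fun i => zero_smul ℝ _,
      h.sum_smul_inj, funext_iff]
    simp only [dvd_iff_isRoot, IsRoot.def]
  refine eq_of_monic_of_associated (monic_minPoly _)
    (monic_prod_of_monic _ _ fun i _ => monic_X_sub_C (a i)) (associated_of_dvd_dvd ?_ ?_)
  · rw [← evalAt_eq_zero_iff_minPoly_dvd, evalAt_eq_zero_iff]
    exact fun i => Finset.dvd_prod_of_mem (fun i => X - C (a i)) (Finset.mem_univ i)
  · refine Finset.prod_dvd_of_coprime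
      (fun i _ j _ hij => pairwise_coprime_X_sub_C ha hij) fun i _ => ?_
    exact (evalAt_eq_zero_iff _).1 (evalAt_eq_zero_iff_minPoly_dvd.2 dvd_rfl) i

theorem natDegree_minPoly_sum_smul {a : ι → ℝ} (ha : Function.Injective a) :
    (minPoly (∑ i, a i • c i)).natDegree = Fintype.card ι := by
  rw [h.minPoly_sum_smul ha, natDegree_prod_of_monic _ _ fun i _ => monic_X_sub_C (a i)]
  simp

theorem card_le_rank : Fintype.card ι ≤ rank V := by
  obtain ⟨n, hn⟩ := Countable.exists_injective_nat ι
  exact (h.natDegree_minPoly_sum_smul (Nat.cast_injective.comp hn)).symm.trans_le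
    (natDegree_minPoly_le_rank _)

end IsIdempotentSystem

theorem IsRegular.exists_isIdempotentSystem {x : V} (hx : IsRegular x) :
    ∃ (s : Finset ℝ) (c : s → V), IsIdempotentSystem c ∧ Fintype.card s = rank V ∧
      x = ∑ a : s, (a : ℝ) • c a := by
  obtain ⟨s, c, h, rfl⟩ := EJA.exists_isIdempotentSystem x
  exact ⟨s, c, h, (h.natDegree_minPoly_sum_smul Subtype.val_injective).symm.trans hx, rfl⟩

/-! ### Peirce decomposition -/

section Peirce

variable {c : V}

theorem commute_mulL_of_idempotent (hc : c * c = c) {a : V} {lam : ℝ} (ha : c * a = lam • a)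
    (hlam : lam ≠ 1 / 2) : Commute (mulL c) (mulL a) := by
  ext v
  simp only [Module.End.mul_apply, mulL_apply]
  have h := jordan_linearized a c v c
  rw [hc, mul_comm a c, ha] at h
  simp only [smul_mul_assoc, mul_smul_comm] at h
  rw [mul_comm v c, mul_comm v a, mul_comm (a * v) c, mul_comm (c * v) a] at h
  have h0 : (1 - 2 * lam) • (c * (a * v) - a * (c * v)) = 0 := by
    linear_combination (norm := module) -h
  exact sub_eq_zero.1 ((smul_eq_zero.1 h0).resolve_left (by contrapose! hlam; linarith))

theorem mul_eq_zero_of_mul_eq_self_of_mul_eq_zero (hc : c * c = c) {a b : V} (ha : c * a = a)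
    (hb : c * b = 0) : a * b = 0 := by
  have hL₁ := commute_mulL_of_idempotent hc (lam := 1) (by simpa using ha) (by norm_num)
  have hL₀ := commute_mulL_of_idempotent hc (lam := 0) (by simpa using hb) (by norm_num)
  calc a * b = b * (c * a) := by rw [ha, mul_comm]
    _ = c * (b * a) := (LinearMap.congr_fun hL₀.eq a).symm
    _ = c * (a * b) := by rw [mul_comm b]
    _ = a * (c * b) := LinearMap.congr_fun hL₁.eq b
    _ = 0 := by rw [hb, mul_zero]

theorem mul_mul_eq_self_of_mul_eq_self (hc : c * c = c) {a b : V} (ha : c * a = a)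
    (hb : c * b = b) : c * (a * b) = a * b := by
  have hL := commute_mulL_of_idempotent hc (lam := 1) (by simpa using ha) (by norm_num)
  calc c * (a * b) = a * (c * b) := LinearMap.congr_fun hL.eq b
    _ = a * b := by rw [hb]

theorem mul_mul_comm_of_mul_eq_zero {d : V} (hc : c * c = c) (hcd : c * d = 0) (x : V) :
    c * (d * x) = d * (c * x) :=
  LinearMap.congr_fun
    (commute_mulL_of_idempotent hc (lam := 0) (by simpa using hcd) (by norm_num)).eq x

theorem mul_mul_mul_eq_half_smul {d : V} (hc : c * c = c) (hcd : c * d = 0) (x : V) :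
    c * (c * (d * x)) = (1 / 2 : ℝ) • (c * (d * x)) := by
  have h := LinearMap.congr_fun (mulL_mul_mul c c d) x
  simp only [hc, hcd, mulL_zero, LinearMap.add_apply, LinearMap.sub_apply, Module.End.mul_apply,
    mulL_apply, LinearMap.zero_apply, zero_add] at h
  rw [← mul_mul_comm_of_mul_eq_zero hc hcd x] at h
  linear_combination (norm := module) (1 / 2 : ℝ) • h

theorem mul_mul_mul_self_of_mul_eq_half_smul (hc : c * c = c) {x : V}
    (hx : c * x = (1 / 2 : ℝ) • x) : c * (c * (x * x)) = c * (x * x) := by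
  have h := jordan_linearized x x c c
  rw [mul_comm x c, hx, hc, mul_comm (x * x) c, mul_comm _ c] at h
  simp only [mul_smul_comm, smul_mul_assoc, hx] at h
  linear_combination (norm := module) h

theorem mul_eq_smul_sub_smul_of_idempotent (hc : c * c = c) (v : V) :
    c * v = (3 : ℝ) • (c * (c * v)) - (2 : ℝ) • (c * (c * (c * v))) := by
  have h := LinearMap.congr_fun (mulL_mul_mul c c c) v
  simp only [hc, LinearMap.add_apply, LinearMap.sub_apply, Module.End.mul_apply, mulL_apply] at h
  linear_combination (norm := module) h

theorem traceForm_idempotent_mul_nonneg (hc : c * c = c) (v : V) :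
    0 ≤ traceForm V (c * v) v := by
  -- With eigenvalues in `{0, 1/2, 1}`, `L(c) = 8 (L(c) - L(c)²)² + (2 L(c)² - L(c))²`.
  have h := mul_eq_smul_sub_smul_of_idempotent hc v
  set u := c * v
  have huv : traceForm V u v = 3 * traceForm V u u - 2 * traceForm V (c * u) u := by
    conv_lhs => rw [h]
    simp only [map_sub, LinearMap.sub_apply, map_smul, LinearMap.smul_apply, smul_eq_mul]
    rw [traceForm_mul_left c u v, traceForm_mul_left c (c * u) v]
  have huu : traceForm V u u = 3 * traceForm V (c * u) u - 2 * traceForm V (c * u) (c * u) := by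
    conv_lhs => enter [1]; rw [h]
    simp only [map_sub, LinearMap.sub_apply, map_smul, LinearMap.smul_apply, smul_eq_mul]
    rw [traceForm_mul_left c (c * u) u]
  have hsum : traceForm V u v = 8 * traceForm V (u - c * u) (u - c * u)
      + traceForm V ((2 : ℝ) • (c * u) - u) ((2 : ℝ) • (c * u) - u) := by
    simp only [map_sub, LinearMap.sub_apply, map_smul, LinearMap.smul_apply, smul_eq_mul,
      traceForm_comm u (c * u)]
    linarith
  rw [hsum]
  have := traceForm_self_nonneg (u - c * u)
  have := traceForm_self_nonneg ((2 : ℝ) • (c * u) - u)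
  positivity

end Peirce

/-! ### Primitive idempotents -/

/-- A nonzero idempotent `c` is primitive if its Peirce space `{z | c * z = z}` is the line `ℝ c`;
this is the form of minimality in which primitivity is used. -/
structure IsPrimitive (c : V) : Prop where
  mul_self : c * c = c
  exists_eq_smul : ∀ z, c * z = z → ∃ a : ℝ, z = a • c

namespace IsIdempotentSystem

variable {ι : Type*} [Fintype ι] {c : ι → V} (h : IsIdempotentSystem c)

include h

theorem exists_evalAt_mul_X_eq {a : ι → ℝ} (ha : Function.Injective a) {i : ι}
    (hi : a i ≠ 0) : ∃ p, evalAt (∑ j, a j • c j) (p * X) = c i := by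
  classical
  refine ⟨C (a i)⁻¹ * Lagrange.basis Finset.univ a i, ?_⟩
  rw [h.evalAt_sum_smul, Fintype.sum_eq_single i]
  · simp [Lagrange.eval_basis_self ha.injOn, hi]
  · intro j hji
    simp [Lagrange.eval_basis_of_ne hji.symm]

theorem mul_eq_zero_of_mul_eq_self {i j : ι} (hij : i ≠ j) {d : V} (hcd : c i * d = d) :
    d * c j = 0 :=
  mul_eq_zero_of_mul_eq_self_of_mul_eq_zero (h.mul_self i) hcd (h.mul_of_ne i j hij)

theorem refine_option [DecidableEq ι] {i : ι} {d : V} (hd : d * d = d) (hd0 : d ≠ 0)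
    (hdc : d ≠ c i) (hcd : c i * d = d) :
    IsIdempotentSystem fun o : Option ι => o.elim d (Function.update c i (c i - d)) := by
  have hdcj : ∀ j, j ≠ i → d * c j = 0 := fun j hj => h.mul_eq_zero_of_mul_eq_self hj.symm hcd
  have hd_mul : ∀ j, d * Function.update c i (c i - d) j = 0 := fun j => by
    rcases eq_or_ne j i with rfl | hj
    · simp [mul_sub, mul_comm d (c j), hcd, hd]
    · simp [hj, hdcj]
  refine ⟨?_, ?_, ?_, ?_⟩
  · rintro (_ | j)
    · exact hd
    rcases eq_or_ne j i with rfl | hj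
    · simp [mul_sub, sub_mul, h.mul_self, hd, mul_comm d, hcd]
    · simp [hj, h.mul_self]
  · rintro (_ | j) (_ | k) hjk
    · exact absurd rfl hjk
    · exact hd_mul k
    · exact (mul_comm _ _).trans (hd_mul j)
    have hjk : j ≠ k := fun e => hjk (congrArg some e)
    rcases eq_or_ne j i with rfl | hj
    · simp [hjk.symm, sub_mul, h.mul_of_ne _ _ hjk, hdcj]
    rcases eq_or_ne k i with rfl | hk
    · simp [hjk, mul_sub, h.mul_of_ne _ _ hjk, mul_comm _ d, hdcj]
    · simp [hj, hk, h.mul_of_ne _ _ hjk]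
  · rintro (_ | j)
    · exact hd0
    rcases eq_or_ne j i with rfl | hj
    · simpa [sub_eq_zero] using hdc.symm
    · simpa [hj] using h.ne_zero j
  · simp only [Fintype.sum_option, Option.elim]
    rw [← h.sum_eq, Finset.sum_update_of_mem (Finset.mem_univ i),
      ← Finset.add_sum_erase _ _ (Finset.mem_univ i), Finset.sdiff_singleton_eq_erase]
    abel

theorem eq_of_mul_eq_self (hcard : Fintype.card ι = rank V) {i : ι} {d : V} (hd : d * d = d)
    (hd0 : d ≠ 0) (hcd : c i * d = d) : d = c i := by
  classical
  by_contra hdc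
  have := (h.refine_option hd hd0 hdc hcd).card_le_rank
  rw [Fintype.card_option, hcard] at this
  omega

theorem isPrimitive (hcard : Fintype.card ι = rank V) (i : ι) : IsPrimitive (c i) := by
  refine ⟨h.mul_self i, fun z hz => ?_⟩
  obtain ⟨s, d, hd, hzd⟩ := exists_isIdempotentSystem z
  have hcomm : Commute (mulL (c i)) (mulL z) :=
    commute_mulL_of_idempotent (h.mul_self i) (lam := 1) (by simpa using hz) (by norm_num)
  have hdc : ∀ a : s, (a : ℝ) ≠ 0 → d a = c i := fun a ha => by
    obtain ⟨p, hp⟩ := hd.exists_evalAt_mul_X_eq Subtype.val_injective ha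
    rw [← hzd, evalAt, map_mul, aeval_X, Module.End.mul_apply, mulL_apply, mul_unit] at hp
    have hcomm_p : Commute (mulL (c i)) (aeval (mulL z) p) :=
      Algebra.commute_of_mem_adjoin_singleton_of_commute (aeval_mem_adjoin_singleton ℝ _) hcomm
    refine h.eq_of_mul_eq_self hcard (hd.mul_self a) (hd.ne_zero a) ?_
    calc c i * d a = aeval (mulL z) p (c i * z) := by
          rw [← hp]; exact LinearMap.congr_fun hcomm_p.eq z
      _ = d a := by rw [hz, hp]
  refine ⟨∑ a : s, (a : ℝ), ?_⟩
  rw [Finset.sum_smul]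
  conv_lhs => rw [hzd]
  refine Finset.sum_congr rfl fun a _ => ?_
  rcases eq_or_ne (a : ℝ) 0 with ha | ha
  · rw [ha, zero_smul, zero_smul]
  · rw [hdc a ha]

end IsIdempotentSystem

namespace IsPrimitive

variable {c d x : V} (hc : IsPrimitive c) (hd : IsPrimitive d) (hcd : c * d = 0)
  (hcx : c * x = (1 / 2 : ℝ) • x) (hdx : d * x = (1 / 2 : ℝ) • x)

include hc hd hcd hcx hdx

theorem exists_mul_self_eq_add : ∃ a b : ℝ, x * x = a • c + b • d := by
  have hdc : d * c = 0 := by rw [mul_comm, hcd]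
  have hcd_idem : (c + d) * (c + d) = c + d := by
    simp [mul_add, add_mul, hc.mul_self, hd.mul_self, hcd, hdc]
  have hcd_x : (c + d) * x = x := by rw [add_mul, hcx, hdx]; module
  have hcd_xx : (c + d) * (x * x) = x * x :=
    mul_mul_eq_self_of_mul_eq_self hcd_idem hcd_x hcd_x
  obtain ⟨a, ha⟩ := hc.exists_eq_smul _ (mul_mul_mul_self_of_mul_eq_half_smul hc.mul_self hcx)
  obtain ⟨b, hb⟩ := hd.exists_eq_smul _ (mul_mul_mul_self_of_mul_eq_half_smul hd.mul_self hdx)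
  exact ⟨a, b, by rw [← ha, ← hb, ← add_mul, hcd_xx]⟩

theorem exists_mul_self_eq_smul_add (hx : x ≠ 0) : ∃ a : ℝ, a ≠ 0 ∧ x * x = a • (c + d) := by
  obtain ⟨a, b, hxx⟩ := exists_mul_self_eq_add hc hd hcd hcx hdx
  have hba : (b - a) • x = 0 := by
    have h := IsCommJordan.lmul_comm_rmul_rmul x c
    rw [mul_comm x c, hcx, hxx] at h
    simp only [mul_add, mul_smul_comm, hc.mul_self, hcd, smul_zero, add_zero, smul_mul_assoc,
      mul_comm x c, mul_comm x d, hcx, hdx] at h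
    linear_combination (norm := module) (4 : ℝ) • h
  obtain rfl : b = a := sub_eq_zero.1 ((smul_eq_zero.1 hba).resolve_right hx)
  refine ⟨b, fun hb => hx (eq_zero_of_traceForm_self_eq_zero ?_), by rw [hxx, smul_add]⟩
  rw [traceForm_apply, hxx, hb, zero_smul, zero_smul, add_zero, mulL_zero, map_zero]

theorem trace_eq_of_mul_eq_half_smul (hx : x ≠ 0) :
    LinearMap.trace ℝ V (mulL c) = LinearMap.trace ℝ V (mulL d) := by
  obtain ⟨a, ha, hxx⟩ := exists_mul_self_eq_smul_add hc hd hcd hcx hdx hx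
  have hcd_trace : traceForm V c d = 0 := by rw [traceForm_apply, hcd, mulL_zero, map_zero]
  have h : traceForm V (x * x) c = traceForm V (x * x) d := by
    rw [traceForm_assoc, traceForm_assoc, mul_comm x c, mul_comm x d, hcx, hdx]
  rw [hxx] at h
  simp only [map_add, map_smul, LinearMap.add_apply, LinearMap.smul_apply, smul_eq_mul, hcd_trace,
    traceForm_comm d c, add_zero, zero_add] at h
  rw [trace_mulL_of_idempotent hc.mul_self, trace_mulL_of_idempotent hd.mul_self]
  exact mul_left_cancel₀ ha h

end IsPrimitive

theorem eq_unit_of_mul_mul_eq_mul [IsSimpleRing V] {c : V} (hc : c * c = c) (hc0 : c ≠ 0)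
    (h : ∀ x, c * (c * x) = c * x) : c = unit V := by
  have hmul : ∀ {x y : V}, c * x = x → c * (x * y) = x * y := fun {x y} hx => by
    have hy : c * (y - c * y) = 0 := by rw [mul_sub, h, sub_self]
    have hxy : x * y = x * (c * y) := by
      rw [← sub_eq_zero, ← mul_sub, mul_eq_zero_of_mul_eq_self_of_mul_eq_zero hc hx hy]
    rw [hxy, mul_mul_eq_self_of_mul_eq_self hc hx (h y)]
  let I : TwoSidedIdeal V := TwoSidedIdeal.mk' {x | c * x = x} (mul_zero c)
    (fun {x y} (hx : c * x = x) (hy : c * y = y) => show c * (x + y) = x + y by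
      rw [mul_add, hx, hy])
    (fun {x} (hx : c * x = x) => show c * -x = -x by rw [mul_neg, hx])
    (fun {x y} hy => show c * (x * y) = x * y by rw [mul_comm x y, hmul hy])
    (fun {x y} hx => hmul hx)
  have mem_I : ∀ x, x ∈ I ↔ c * x = x := fun x => TwoSidedIdeal.mem_mk' _ _ _ _ _ _ x
  rcases eq_bot_or_eq_top I with hbot | htop
  · have : c ∈ I := (mem_I c).2 hc
    rw [hbot, TwoSidedIdeal.mem_bot] at this
    exact absurd this hc0
  · have : unit V ∈ I := by rw [htop]; trivial
    rwa [mem_I, mul_unit] at this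

namespace IsIdempotentSystem

variable {ι : Type*} [Fintype ι] {c : ι → V} (h : IsIdempotentSystem c)

include h

/-- If all these products vanished, then `∑ k ∈ S, c k` would be an idempotent without half Peirce
space, hence `e`. -/
theorem exists_mul_mul_ne_zero [IsSimpleRing V] {S : Set ι} {i j : ι} (hi : i ∈ S) (hj : j ∉ S) :
    ∃ k ∈ S, ∃ l ∉ S, ∃ x, c k * (c l * x) ≠ 0 := by
  classical
  by_contra! hS
  let E := ∑ k, S.indicator (1 : ι → ℝ) k • c k
  have hE_idem : E * E = E := by
    simp only [E, h.sum_smul_mul_sum_smul]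
    exact Finset.sum_congr rfl fun k _ => by by_cases hk : k ∈ S <;> simp [hk]
  have hEi : E * c i = c i := by simp [E, h.sum_smul_mul, hi]
  have hEj : E * c j = 0 := by simp [E, h.sum_smul_mul, hj]
  have hE_compl : unit V - E = ∑ l, Sᶜ.indicator (1 : ι → ℝ) l • c l := by
    rw [← h.sum_eq, ← Finset.sum_sub_distrib]
    exact Finset.sum_congr rfl fun l _ => by by_cases hl : l ∈ S <;> simp [hl]
  have hE_mul : ∀ x, E * ((unit V - E) * x) = 0 := fun x => by
    rw [hE_compl, Finset.sum_mul, Finset.sum_mul]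
    refine Finset.sum_eq_zero fun k _ => ?_
    rw [Finset.mul_sum]
    refine Finset.sum_eq_zero fun l _ => ?_
    by_cases hk : k ∈ S <;> by_cases hl : l ∈ S <;> simp [hk, hl, hS]
  have hE_unit : E = unit V := by
    refine eq_unit_of_mul_mul_eq_mul hE_idem (fun hE => h.ne_zero i ?_) fun x => ?_
    · rw [← hEi, hE, zero_mul]
    · have := hE_mul x
      rw [sub_mul, unit_mul, mul_sub, sub_eq_zero] at this
      exact this.symm
  rw [hE_unit, unit_mul] at hEj
  exact h.ne_zero j hEj

theorem trace_eq [IsSimpleRing V] (hcard : Fintype.card ι = rank V) (i j : ι) :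
    LinearMap.trace ℝ V (mulL (c i)) = LinearMap.trace ℝ V (mulL (c j)) := by
  by_contra hij
  obtain ⟨k, hk, l, hl, x, hx⟩ := h.exists_mul_mul_ne_zero
    (S := {k | LinearMap.trace ℝ V (mulL (c k)) = LinearMap.trace ℝ V (mulL (c i))}) rfl
    (Ne.symm hij)
  have hkl : k ≠ l := fun e => hl (e ▸ hk)
  refine hl (Eq.trans ?_ hk)
  refine (h.isPrimitive hcard l).trace_eq_of_mul_eq_half_smul (h.isPrimitive hcard k)
    (h.mul_of_ne l k hkl.symm) ?_ (mul_mul_mul_eq_half_smul (h.mul_self k) (h.mul_of_ne k l hkl) x)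
    hx
  rw [mul_mul_comm_of_mul_eq_zero (h.mul_self k) (h.mul_of_ne k l hkl)]
  exact mul_mul_mul_eq_half_smul (h.mul_self l) (h.mul_of_ne l k hkl.symm) x

theorem rank_mul_trace [IsSimpleRing V] (hcard : Fintype.card ι = rank V) (i : ι) :
    (rank V : ℝ) * LinearMap.trace ℝ V (mulL (c i)) = Module.finrank ℝ V := by
  rw [← LinearMap.trace_one ℝ V, ← mulL_unit, ← h.sum_eq, mulL_sum, map_sum,
    Finset.sum_congr rfl fun j _ => h.trace_eq hcard j i]
  simp [hcard]

end IsIdempotentSystem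

/-! ### Exponentials of endomorphisms -/

section EndExp

variable {E : Type*} [NormedAddCommGroup E]

section

variable [NormedSpace ℝ E] [FiniteDimensional ℝ E]

/-- The exponential of an endomorphism of a finite-dimensional normed space. Going through linear
maps keeps it applicable to `V`, whose additive group does not come from its norm. -/
noncomputable def endExp (A : Module.End ℝ E) : Module.End ℝ E :=
  (NormedSpace.exp (LinearMap.toContinuousLinearMap A) : E →L[ℝ] E)

theorem endExp_zero : endExp (0 : Module.End ℝ E) = 1 := by
  rw [endExp, map_zero, NormedSpace.exp_zero]
  rfl

theorem endExp_neg_mul (A : Module.End ℝ E) : endExp (-A) * endExp A = 1 := by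
  let : NormedAlgebra ℚ (E →L[ℝ] E) := NormedAlgebra.restrictScalars ℚ ℝ _
  have h := NormedSpace.exp_add_of_commute
    (Commute.refl (LinearMap.toContinuousLinearMap A)).neg_left
  rw [neg_add_cancel, NormedSpace.exp_zero] at h
  rw [endExp, endExp, map_neg]
  exact congrArg ContinuousLinearMap.toLinearMap h.symm

theorem hasDerivAt_endExp_smul_apply (A : Module.End ℝ E) (v : E) (t : ℝ) :
    HasDerivAt (fun t : ℝ => endExp (t • A) v) (A (endExp (t • A) v)) t := by
  have h := (hasDerivAt_exp_smul_const' (LinearMap.toContinuousLinearMap A) t).clm_apply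
    (hasDerivAt_const t v)
  rw [map_zero, add_zero] at h
  simpa only [endExp, map_smul] using! h

theorem endExp_apply_zero_eq_of_hasDerivAt {A : Module.End ℝ E} {γ : ℝ → E}
    (hγ : ∀ t, HasDerivAt γ (A (γ t)) t) : endExp A (γ 0) = γ 1 := by
  have hconst : ∀ t, HasDerivAt (fun t : ℝ => endExp (t • -A) (γ t)) 0 t := fun t => by
    have h := (hasDerivAt_exp_smul_const (LinearMap.toContinuousLinearMap (-A)) t).clm_apply (hγ t)
    convert h using 1
    · simp [endExp]
    · rw [mul_apply_eq_comp, ← map_add]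
      simp
  have h := is_const_of_deriv_eq_zero (fun t => (hconst t).differentiableAt)
    (fun t => (hconst t).deriv) 0 1
  simp only [zero_smul, one_smul, endExp_zero, Module.End.one_apply] at h
  have hinv := endExp_neg_mul (-A)
  rw [neg_neg] at hinv
  rw [h, ← Module.End.mul_apply, hinv, Module.End.one_apply]

theorem endExp_apply_of_apply_eq_smul {A : Module.End ℝ E} {v : E} {a : ℝ} (hv : A v = a • v) :
    endExp A v = Real.exp a • v := by
  have h := endExp_apply_zero_eq_of_hasDerivAt (A := A) (γ := fun t => Real.exp (t * a) • v)
    fun t => by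
      have h := ((hasDerivAt_id t).mul_const a).exp.smul_const v
      simpa [hv, smul_smul] using h
  simpa using h

end

theorem det_endExp_of_isSymmetric [InnerProductSpace ℝ E] [FiniteDimensional ℝ E]
    {A : Module.End ℝ E} (hA : A.IsSymmetric) :
    LinearMap.det (endExp A) = Real.exp (LinearMap.trace ℝ E A) := by
  let b := (hA.eigenvectorBasis rfl).toBasis
  have hb : LinearMap.toMatrix b b (endExp A)
      = Matrix.diagonal fun i => Real.exp (hA.eigenvalues rfl i) := by
    ext i j
    have hbj : A (b j) = hA.eigenvalues rfl j • b j := by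
      simp [b]
    rw [LinearMap.toMatrix_apply, endExp_apply_of_apply_eq_smul hbj]
    by_cases hij : i = j <;> simp [hij]
  rw [← LinearMap.det_toMatrix b, hb, Matrix.det_diagonal, hA.trace_eq_sum_eigenvalues rfl]
  simp [Real.exp_sum]

end EndExp

theorem continuous_det_of_forall_continuous_apply {X E : Type*} [TopologicalSpace X]
    [NormedAddCommGroup E] [NormedSpace ℝ E] [FiniteDimensional ℝ E] {f : X → Module.End ℝ E}
    (hf : ∀ v, Continuous fun x => f x v) : Continuous fun x => LinearMap.det (f x) := by
  let b := Module.finBasis ℝ E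
  simp only [← LinearMap.det_toMatrix b]
  refine Continuous.matrix_det (continuous_matrix fun i j => ?_)
  simp only [LinearMap.toMatrix_apply]
  exact (b.coord i).continuous_of_finiteDimensional.comp (hf (b j))

/-! ### The symmetric cone -/

namespace IsIdempotentSystem

variable {ι : Type*} [Fintype ι] {c : ι → V} (h : IsIdempotentSystem c)

include h

theorem traceForm_sum_smul_mul_pos {a : ι → ℝ} (ha : ∀ i, 0 < a i) {v : V} (hv : v ≠ 0) :
    0 < traceForm V ((∑ i, a i • c i) * v) v := by
  have expand : ∀ a : ι → ℝ, traceForm V ((∑ i, a i • c i) * v) v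
      = ∑ i, a i * traceForm V (c i * v) v := fun a => by
    simp [Finset.sum_mul, smul_mul_assoc]
  have nonneg : ∀ i, 0 ≤ traceForm V (c i * v) v := fun i =>
    traceForm_idempotent_mul_nonneg (h.mul_self i) v
  have sum_pos : 0 < ∑ i, traceForm V (c i * v) v := by
    have hsum := expand fun _ => 1
    simp only [one_smul, h.sum_eq, unit_mul, one_mul] at hsum
    exact hsum ▸ EuclideanJordanAlgebra.traceForm_pos v hv
  obtain ⟨i, hi, hpos⟩ := (Finset.sum_pos_iff_of_nonneg fun i _ => nonneg i).1 sum_pos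
  rw [expand]
  exact Finset.sum_pos' (fun j _ => mul_nonneg (ha j).le (nonneg j)) ⟨i, hi, mul_pos (ha i) hpos⟩

theorem pos_of_traceForm_mul_pos {a : ι → ℝ}
    (hpos : ∀ v : V, v ≠ 0 → 0 < traceForm V ((∑ i, a i • c i) * v) v) (i : ι) : 0 < a i := by
  have hi := hpos (c i) (h.ne_zero i)
  rw [h.sum_smul_mul, map_smul, LinearMap.smul_apply, smul_eq_mul] at hi
  exact pos_of_mul_pos_left hi (traceForm_self_nonneg _)

theorem isInvertible_sum_smul_iff {a : ι → ℝ} :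
    IsInvertible (∑ i, a i • c i) ↔ ∀ i, a i ≠ 0 := by
  classical
  have isInverse_iff : ∀ p : ℝ[X], (∑ i, a i • c i) * evalAt (∑ i, a i • c i) p = unit V ↔
      ∀ i, a i * p.eval (a i) = 1 := fun p => by
    rw [h.evalAt_sum_smul, h.sum_smul_mul_sum_smul, ← h.sum_eq,
      ← funext_iff (g := fun _ => (1 : ℝ)), ← h.sum_smul_inj]
    simp only [one_smul]
  simp only [IsInvertible, isInverse_iff]
  refine ⟨fun ⟨p, hp⟩ i => left_ne_zero_of_mul_eq_one (hp i), fun ha => ?_⟩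
  refine ⟨Lagrange.interpolate (Finset.univ.image a) id fun t => t⁻¹, fun i => ?_⟩
  have heval := Lagrange.eval_interpolate_at_node (fun t => t⁻¹) (Function.injective_id.injOn)
    (Finset.mem_image_of_mem a (Finset.mem_univ i))
  rw [id] at heval
  rw [heval, mul_inv_cancel₀ (ha i)]

end IsIdempotentSystem

theorem mem_cone_iff {y : V} : y ∈ cone V ↔ ∀ v : V, v ≠ 0 → 0 < traceForm V (y * v) v := by
  constructor
  · rintro ⟨x, hx, rfl⟩ v hv
    obtain ⟨s, c, h, rfl⟩ := exists_isIdempotentSystem x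
    rw [h.sum_smul_mul_sum_smul]
    exact h.traceForm_sum_smul_mul_pos
      (fun i => mul_self_pos.2 (h.isInvertible_sum_smul_iff.1 hx i)) hv
  · intro hy
    obtain ⟨s, c, h, rfl⟩ := exists_isIdempotentSystem y
    have hpos := h.pos_of_traceForm_mul_pos hy
    refine ⟨∑ i : s, √(i : ℝ) • c i,
      h.isInvertible_sum_smul_iff.2 fun i => (Real.sqrt_pos.2 (hpos i)).ne', ?_⟩
    rw [h.sum_smul_mul_sum_smul]
    exact Finset.sum_congr rfl fun i _ => by rw [Real.mul_self_sqrt (hpos i).le]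

theorem IsIdempotentSystem.sum_smul_mem_cone_iff {ι : Type*} [Fintype ι] {c : ι → V}
    (h : IsIdempotentSystem c) {a : ι → ℝ} : ∑ i, a i • c i ∈ cone V ↔ ∀ i, 0 < a i :=
  ⟨fun ha => h.pos_of_traceForm_mul_pos (mem_cone_iff.1 ha),
    fun ha => mem_cone_iff.2 fun _ => h.traceForm_sum_smul_mul_pos ha⟩

theorem unit_mem_cone : unit V ∈ cone V :=
  mem_cone_iff.2 fun v hv => by
    rw [unit_mul]
    exact EuclideanJordanAlgebra.traceForm_pos v hv

variable (V) in
/-- The multiplication of `V` as a continuous bilinear map. -/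
noncomputable def mulCLM : V →L[ℝ] V →L[ℝ] V := (LinearMap.mul ℝ V).toContinuousBilinearMap

variable (V) in
theorem continuous_mul_uncurry : Continuous fun p : V × V => p.1 * p.2 := (mulCLM V).continuous₂

variable (V) in
theorem continuous_traceForm_mul_self :
    Continuous fun p : V × V => traceForm V (p.1 * p.2) p.2 :=
  (continuous_mul_uncurry V).inner continuous_snd

theorem isOpen_cone : IsOpen (cone V) := by
  rw [isOpen_iff_mem_nhds]
  intro y hy
  have pos_near : ∀ᶠ z in nhds y, ∀ v ∈ Metric.sphere (0 : V) 1, 0 < traceForm V (z * v) v := by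
    refine (isCompact_sphere 0 1).eventually_forall_of_forall_eventually fun v hv => ?_
    exact (continuous_traceForm_mul_self V).continuousAt.eventually_const_lt
      (mem_cone_iff.1 hy v (ne_zero_of_mem_unit_sphere ⟨v, hv⟩))
  filter_upwards [pos_near] with z hz
  refine mem_cone_iff.2 fun v hv => ?_
  have hunit := hz (‖v‖⁻¹ • v) (by simp [norm_smul, hv])
  rw [mul_smul_comm, map_smul, map_smul, LinearMap.smul_apply, smul_smul, smul_eq_mul] at hunit
  exact pos_of_mul_pos_right hunit (by positivity)

theorem traceForm_mul_self_nonneg_of_mem_closure_cone {y : V} (hy : y ∈ closure (cone V)) (v : V) :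
    0 ≤ traceForm V (y * v) v := by
  have hclosed : IsClosed {y : V | 0 ≤ traceForm V (y * v) v} :=
    isClosed_le continuous_const ((continuous_traceForm_mul_self V).comp
      (continuous_id.prodMk continuous_const))
  refine closure_minimal (fun z hz => ?_) hclosed hy
  rcases eq_or_ne v 0 with rfl | hv
  · simp
  · exact (mem_cone_iff.1 hz v hv).le

/-! ### The quadratic representation -/

/-- The quadratic representation `P(x) = 2 L(x)² - L(x²)`. -/
noncomputable def quadRep (x : V) : Module.End ℝ V := (2 : ℝ) • (mulL x * mulL x) - mulL (x * x)

omit [EuclideanJordanAlgebra V] in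
theorem quadRep_apply (x v : V) : quadRep x v = (2 : ℝ) • (x * (x * v)) - x * x * v := rfl

theorem quadRep_unit : quadRep (unit V) = 1 := by
  ext v
  simp only [quadRep_apply, unit_mul, Module.End.one_apply]
  module

-- The left-hand side is the derivative of `P` at `w` in the direction `h * w`, applied to `v`.
theorem quadRep_linearized_mul_apply (h w v : V) :
    (2 : ℝ) • (h * w * (w * v) + w * (h * w * v)) - (2 : ℝ) • (h * w * w * v)
      = h * quadRep w v + quadRep w (h * v) := by
  rw [quadRep_apply, quadRep_apply, mul_sub, mul_smul_comm]
  have h₁ := jordan_linearized h w w v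
  have h₂ := jordan_linearized w w v h
  rw [mul_comm v (w * h), mul_comm (w * w * v) h, mul_comm w h, mul_comm (w * v) (h * w),
    mul_comm v h] at h₂
  linear_combination (norm := module) (-2 : ℝ) • h₁ + h₂

theorem continuous_det_quadRep : Continuous fun x : V => LinearMap.det (quadRep x) := by
  refine continuous_det_of_forall_continuous_apply fun v => ?_
  have hmul {f g : V → V} (hf : Continuous f) (hg : Continuous g) :
      Continuous fun x => f x * g x := (continuous_mul_uncurry V).comp (hf.prodMk hg)
  exact ((hmul continuous_id (hmul continuous_id continuous_const)).const_smul _).sub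
    (hmul (hmul continuous_id continuous_id) continuous_const)

/-- The operator `exp L(h)`, which turns out to be an automorphism of the symmetric cone. -/
noncomputable def expMulL (h : V) : Module.End ℝ V := endExp (E := V) (mulL h)

theorem expMulL_zero : expMulL (0 : V) = 1 := by
  rw [expMulL, mulL_zero, endExp_zero]

theorem expMulL_neg_mul (h : V) : expMulL (-h) * expMulL h = 1 := by
  rw [expMulL, expMulL, ← neg_one_smul ℝ h, mulL_smul, neg_one_smul, endExp_neg_mul]

theorem expMulL_apply_of_mul_eq_smul {h v : V} {a : ℝ} (hv : h * v = a • v) :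
    expMulL h v = Real.exp a • v :=
  endExp_apply_of_apply_eq_smul hv

theorem det_expMulL (h : V) :
    LinearMap.det (expMulL h) = Real.exp (LinearMap.trace ℝ V (mulL h)) :=
  det_endExp_of_isSymmetric (isSymmetric_mulL h)

theorem det_expMulL_pos (h : V) : 0 < LinearMap.det (expMulL h) :=
  det_expMulL h ▸ Real.exp_pos _

theorem hasDerivAt_expMulL_smul_apply (h v : V) (t : ℝ) :
    HasDerivAt (fun t : ℝ => expMulL (t • h) v) (h * expMulL (t • h) v) t := by
  simpa only [expMulL, mulL_smul, mulL_apply] using hasDerivAt_endExp_smul_apply (mulL h) v t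

theorem hasDerivAt_mul {f g : ℝ → V} {f' g' : V} {t : ℝ} (hf : HasDerivAt f f' t)
    (hg : HasDerivAt g g' t) : HasDerivAt (fun t => f t * g t) (f t * g' + f' * g t) t :=
  (mulCLM V).hasDerivAt_of_bilinear (fun _ => hf) fun _ => hg

theorem hasDerivAt_quadRep_apply {f g : ℝ → V} {f' g' : V} {t : ℝ} (hf : HasDerivAt f f' t)
    (hg : HasDerivAt g g' t) : HasDerivAt (fun t => quadRep (f t) (g t))
      ((2 : ℝ) • (f' * (f t * g t) + f t * (f' * g t)) - (2 : ℝ) • (f' * f t * g t)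
        + quadRep (f t) g') t := by
  refine (((hasDerivAt_mul hf (hasDerivAt_mul hf hg)).const_smul (2 : ℝ)).sub
    (hasDerivAt_mul (hasDerivAt_mul hf hf) hg)).congr_deriv ?_
  rw [quadRep_apply, mul_comm (f t) f', mul_add, add_mul]
  module

theorem expMulL_quadRep_apply (h w v : V) :
    expMulL h (quadRep w v) = quadRep (expMulL h w) (expMulL (-h) v) := by
  -- `t ↦ P(exp(t L(h)) w) (exp(-t L(h)) v)` solves the linear equation `γ' = L(h) γ`.
  have hsol : ∀ t : ℝ, HasDerivAt (fun t : ℝ => quadRep (expMulL (t • h) w) (expMulL (t • -h) v))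
      (mulL h (quadRep (expMulL (t • h) w) (expMulL (t • -h) v))) t := fun t => by
    refine (hasDerivAt_quadRep_apply (hasDerivAt_expMulL_smul_apply h w t)
      (hasDerivAt_expMulL_smul_apply (-h) v t)).congr_deriv ?_
    rw [quadRep_linearized_mul_apply, neg_mul, map_neg, add_neg_cancel_right, mulL_apply]
  simpa only [zero_smul, one_smul, expMulL_zero, Module.End.one_apply] using!
    endExp_apply_zero_eq_of_hasDerivAt (E := V) hsol

theorem quadRep_expMulL_apply (h w : V) :
    quadRep (expMulL h w) = expMulL h * quadRep w * expMulL h := by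
  ext v
  simp only [Module.End.mul_apply]
  rw [expMulL_quadRep_apply, ← Module.End.mul_apply (expMulL (-h)), expMulL_neg_mul,
    Module.End.one_apply]

theorem det_quadRep_expMulL_apply (h w : V) : LinearMap.det (quadRep (expMulL h w))
    = LinearMap.det (expMulL h) ^ 2 * LinearMap.det (quadRep w) := by
  rw [quadRep_expMulL_apply, map_mul, map_mul]
  ring

theorem IsIdempotentSystem.expMulL_sum_log_smul_unit {ι : Type*} [Fintype ι] {c : ι → V}
    (h : IsIdempotentSystem c) {a : ι → ℝ} (ha : ∀ i, 0 < a i) :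
    expMulL (∑ i, Real.log (a i) • c i) (unit V) = ∑ i, a i • c i := by
  conv_lhs => rw [← h.sum_eq]
  rw [map_sum]
  refine Finset.sum_congr rfl fun i _ => ?_
  rw [expMulL_apply_of_mul_eq_smul (h.sum_smul_mul _ i), Real.exp_log (ha i)]

theorem exists_expMulL_unit_eq {y : V} (hy : y ∈ cone V) : ∃ h : V, expMulL h (unit V) = y := by
  obtain ⟨s, c, h, rfl⟩ := exists_isIdempotentSystem y
  exact ⟨_, h.expMulL_sum_log_smul_unit (h.sum_smul_mem_cone_iff.1 hy)⟩

theorem det_quadRep_expMulL_unit (h : V) :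
    LinearMap.det (quadRep (expMulL h (unit V))) = LinearMap.det (expMulL h) ^ 2 := by
  rw [det_quadRep_expMulL_apply, quadRep_unit, map_one, mul_one]

theorem det_quadRep_pos {y : V} (hy : y ∈ cone V) : 0 < LinearMap.det (quadRep y) := by
  obtain ⟨h, rfl⟩ := exists_expMulL_unit_eq hy
  rw [det_quadRep_expMulL_unit]
  exact pow_pos (det_expMulL_pos h) 2

theorem mem_cone_of_mem_closure {y : V} (hy : y ∈ closure (cone V))
    (hdet : LinearMap.det (quadRep y) ≠ 0) : y ∈ cone V := by
  obtain ⟨s, c, h, rfl⟩ := exists_isIdempotentSystem y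
  refine h.sum_smul_mem_cone_iff.2 fun i => ?_
  have hnonneg := traceForm_mul_self_nonneg_of_mem_closure_cone hy (c i)
  rw [h.sum_smul_mul, map_smul, LinearMap.smul_apply, smul_eq_mul] at hnonneg
  refine (nonneg_of_mul_nonneg_left hnonneg
    (EuclideanJordanAlgebra.traceForm_pos _ (h.ne_zero i))).lt_of_ne fun hi => hdet ?_
  refine LinearMap.det_eq_zero_iff_ker_ne_bot.2
    ((Submodule.ne_bot_iff _).2 ⟨c i, ?_, h.ne_zero i⟩)
  rw [LinearMap.mem_ker, quadRep_apply, h.sum_smul_mul_sum_smul, h.sum_smul_mul, h.sum_smul_mul,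
    ← hi]
  simp

theorem expMulL_mem_cone (h : V) {w : V} (hw : w ∈ cone V) : expMulL h w ∈ cone V := by
  let γ : ℝ → V := fun t => expMulL (t • h) w
  have hγ : Continuous γ := continuous_iff_continuousAt.2 fun t =>
    (hasDerivAt_expMulL_smul_apply h w t).continuousAt
  have hclopen : IsClopen (γ ⁻¹' cone V) := by
    refine ⟨isClosed_of_closure_subset fun t ht => ?_, isOpen_cone.preimage hγ⟩
    refine mem_cone_of_mem_closure (hγ.closure_preimage_subset _ ht) ?_
    rw [det_quadRep_expMulL_apply]
    exact (mul_pos (pow_pos (det_expMulL_pos _) 2) (det_quadRep_pos hw)).ne'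
  have hzero : (0 : ℝ) ∈ γ ⁻¹' cone V := by
    simpa [γ, expMulL_zero] using hw
  have hone : (1 : ℝ) ∈ γ ⁻¹' cone V := hclopen.eq_univ ⟨0, hzero⟩ ▸ Set.mem_univ 1
  simpa [γ] using hone

/-! ### Density of the regular elements -/

theorem dense_setOf_linearIndependent {E F ι : Type*} [NormedAddCommGroup E] [NormedSpace ℝ E]
    [NormedAddCommGroup F] [InnerProductSpace ℝ F] [Finite ι] {v : ι → E → F}
    (hv : ∀ i, AnalyticOnNhd ℝ (v i) Set.univ) {x₁ : E}
    (h₁ : LinearIndependent ℝ fun i => v i x₁) :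
    Dense {x | LinearIndependent ℝ fun i => v i x} := by
  classical
  have := Fintype.ofFinite ι
  let G : E → ℝ := fun x => (Matrix.gram ℝ fun i => v i x).det
  have hG : AnalyticOnNhd ℝ G Set.univ := fun x hx => by
    simp only [G, Matrix.det_apply', Matrix.gram_apply]
    exact Finset.analyticAt_fun_sum _ fun σ _ => analyticAt_const.mul <|
      Finset.analyticAt_fun_prod _ fun i _ =>
        ((innerSL ℝ (E := F)).analyticAt_bilinear _).comp₂ (hv _ x hx) (hv _ x hx)
  have G_ne_zero_iff : ∀ x, G x ≠ 0 ↔ LinearIndependent ℝ fun i => v i x := fun x =>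
    Matrix.det_gram_ne_zero_iff_linearIndependent
  simp only [← G_ne_zero_iff] at h₁ ⊢
  intro x
  by_contra hx
  rw [mem_closure_iff_frequently, Filter.not_frequently] at hx
  exact h₁ (hG.eqOn_zero_of_preconnected_of_eventuallyEq_zero isPreconnected_univ
    (Set.mem_univ x) (hx.mono fun _ => not_not.1) (Set.mem_univ x₁))

theorem isRegular_iff_linearIndependent {x : V} :
    IsRegular x ↔ LinearIndependent ℝ fun k : Fin (rank V) => (mulL x ^ (k : ℕ)) (unit V) := by
  have evalAt_degreeLT : ∀ g : Fin (rank V) → ℝ, evalAt x (∑ k, C (g k) * X ^ (k : ℕ))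
      = ∑ k, g k • (mulL x ^ (k : ℕ)) (unit V) := fun g => by
    simp only [evalAt_sum, evalAt_C_mul, evalAt_X_pow]
  rw [Fintype.linearIndependent_iff]
  constructor
  · intro hx g hg
    rw [← evalAt_degreeLT, evalAt_eq_zero_iff_minPoly_dvd] at hg
    have hzero : ∑ k, C (g k) * X ^ (k : ℕ) = 0 := eq_zero_of_dvd_of_degree_lt hg <|
      (degree_sum_fin_lt g).trans_eq <| by
        rw [degree_eq_natDegree (monic_minPoly x).ne_zero,
          show (minPoly x).natDegree = rank V from hx]
    intro k
    simpa [finsetSum_coeff, coeff_X_pow, Fin.val_inj] using congrArg (coeff · k) hzero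
  · intro hli
    refine (natDegree_minPoly_le_rank x).eq_or_lt.resolve_right fun hlt => ?_
    have hminPoly := evalAt_degreeLT fun k => (minPoly x).coeff k
    rw [Fin.sum_univ_eq_sum_range (fun k => C ((minPoly x).coeff k) * X ^ k),
      ← as_sum_range_C_mul_X_pow' _ hlt, evalAt_eq_zero_iff_minPoly_dvd.2 dvd_rfl] at hminPoly
    have hlead : (minPoly x).coeff (minPoly x).natDegree = 1 := monic_minPoly x
    exact one_ne_zero (hlead.symm.trans (hli _ hminPoly.symm ⟨_, hlt⟩))

theorem analyticOnNhd_mulL_pow_apply (k : ℕ) (v : V) :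
    AnalyticOnNhd ℝ (fun x : V => (mulL x ^ k) v) Set.univ := by
  induction k with
  | zero => exact fun _ _ => analyticAt_const
  | succ k ih =>
    simp only [pow_succ', Module.End.mul_apply, mulL_apply]
    exact fun x hx => ((mulCLM V).analyticAt_bilinear _).comp₂ analyticAt_id (ih x hx)

variable (V) in
theorem dense_isRegular : Dense {x : V | IsRegular x} := by
  obtain ⟨x, hx⟩ := exists_isRegular V
  simp only [isRegular_iff_linearIndependent] at hx ⊢
  exact dense_setOf_linearIndependent (E := V) (F := V)
    (fun k => analyticOnNhd_mulL_pow_apply k (unit V)) hx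

/-! ### The Jordan determinant on the cone -/

variable (V) in
/-- The exponent `2n/r` relating the Jordan determinant to the determinant of the quadratic
representation. -/
noncomputable def genus : ℝ := 2 * (Module.finrank ℝ V : ℝ) / (rank V : ℝ)

theorem unit_ne_zero [Nontrivial V] : unit V ≠ 0 := fun h => by
  obtain ⟨x, hx⟩ := exists_ne (0 : V)
  exact hx (by rw [← unit_mul x, h, zero_mul])

variable (V) in
theorem rank_pos [Nontrivial V] : 0 < rank V :=
  IsIdempotentSystem.card_le_rank (c := fun _ : Unit => unit V)
    ⟨fun _ => unit_mul _, fun _ _ h => absurd rfl h, fun _ => unit_ne_zero, by simp⟩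

variable (V) in
theorem genus_ne_zero [Nontrivial V] : genus V ≠ 0 :=
  div_ne_zero (mul_ne_zero two_ne_zero (Nat.cast_ne_zero.2 Module.finrank_pos.ne'))
    (Nat.cast_ne_zero.2 (rank_pos V).ne')

namespace IsIdempotentSystem

variable {ι : Type*} [Fintype ι] {c : ι → V} (h : IsIdempotentSystem c) {a : ι → ℝ}

include h

theorem neg_one_pow_card_mul_coeff_zero_minPoly (ha : Function.Injective a) :
    (-1) ^ Fintype.card ι * (minPoly (∑ i, a i • c i)).coeff 0 = ∏ i, a i := by
  rw [h.minPoly_sum_smul ha, coeff_zero_eq_eval_zero, eval_prod, ← Finset.card_univ,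
    ← Finset.prod_const, ← Finset.prod_mul_distrib]
  simp

theorem det_quadRep_sum_smul [IsSimpleRing V] (hcard : Fintype.card ι = rank V)
    (ha : ∀ i, 0 < a i) :
    LinearMap.det (quadRep (∑ i, a i • c i)) = (∏ i, a i) ^ genus V := by
  have trace_eq_genus : ∀ i, 2 * LinearMap.trace ℝ V (mulL (c i)) = genus V := fun i => by
    rw [genus, eq_div_iff (Nat.cast_ne_zero.2 (rank_pos V).ne'), ← h.rank_mul_trace hcard i]
    ring
  rw [← h.expMulL_sum_log_smul_unit ha, det_quadRep_expMulL_unit, det_expMulL, ← Real.exp_nat_mul,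
    Real.rpow_def_of_pos (Finset.prod_pos fun i _ => ha i), Real.log_prod fun i _ => (ha i).ne',
    mulL_sum, map_sum, Finset.mul_sum, Finset.sum_mul]
  congr 1
  refine Finset.sum_congr rfl fun i _ => ?_
  rw [mulL_smul, map_smul, smul_eq_mul, Nat.cast_ofNat, mul_left_comm, trace_eq_genus]

end IsIdempotentSystem

theorem continuousOn_det_quadRep_rpow (s : ℝ) :
    ContinuousOn (fun y : V => LinearMap.det (quadRep y) ^ s) (cone V) :=
  continuous_det_quadRep.continuousOn.rpow_const fun _ hy => Or.inl (det_quadRep_pos hy).ne'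

section SimpleAlgebra

variable [IsSimpleRing V]

theorem IsRegular.neg_one_pow_rank_mul_coeff_zero_minPoly {y : V} (hreg : IsRegular y)
    (hy : y ∈ cone V) : (-1) ^ rank V * (minPoly y).coeff 0
      = LinearMap.det (quadRep y) ^ (genus V)⁻¹ := by
  obtain ⟨s, c, h, hcard, rfl⟩ := hreg.exists_isIdempotentSystem
  have hpos := h.sum_smul_mem_cone_iff.1 hy
  rw [h.det_quadRep_sum_smul hcard hpos, ← hcard,
    h.neg_one_pow_card_mul_coeff_zero_minPoly Subtype.val_injective,
    Real.rpow_rpow_inv (Finset.prod_nonneg fun i _ => (hpos i).le) (genus_ne_zero V)]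

theorem jdet_eq_det_quadRep_rpow {y : V} (hy : y ∈ cone V) :
    jdet y = LinearMap.det (quadRep y) ^ (genus V)⁻¹ := by
  have hlim := ((continuousOn_det_quadRep_rpow (genus V)⁻¹).continuousAt
    (isOpen_cone.mem_nhds hy)).tendsto
  refine extendFrom_eq (dense_isRegular V y) ((hlim.mono_left nhdsWithin_le_nhds).congr' ?_)
  filter_upwards [self_mem_nhdsWithin, mem_nhdsWithin_of_mem_nhds (isOpen_cone.mem_nhds hy)]
    with x hreg hx
  exact (IsRegular.neg_one_pow_rank_mul_coeff_zero_minPoly hreg hx).symm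

theorem jdet_pos {y : V} (hy : y ∈ cone V) : 0 < jdet y := by
  rw [jdet_eq_det_quadRep_rpow hy]
  exact Real.rpow_pos_of_pos (det_quadRep_pos hy) _

theorem jdet_unit : jdet (unit V) = 1 := by
  rw [jdet_eq_det_quadRep_rpow unit_mem_cone, quadRep_unit, map_one, Real.one_rpow]

theorem continuousOn_jdet : ContinuousOn (jdet : V → ℝ) (cone V) :=
  (continuousOn_det_quadRep_rpow _).congr fun _ hy => jdet_eq_det_quadRep_rpow hy

theorem jdet_expMulL_unit_rpow_genus (h : V) :
    jdet (expMulL h (unit V)) ^ genus V = LinearMap.det (expMulL h) ^ 2 := by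
  rw [jdet_eq_det_quadRep_rpow (expMulL_mem_cone h unit_mem_cone), det_quadRep_expMulL_unit,
    Real.rpow_inv_rpow (sq_nonneg _) (genus_ne_zero V)]

theorem jdet_expMulL_apply (h : V) {w : V} (hw : w ∈ cone V) :
    jdet (expMulL h w) = jdet (expMulL h (unit V)) * jdet w := by
  rw [jdet_eq_det_quadRep_rpow (expMulL_mem_cone h hw), jdet_eq_det_quadRep_rpow hw,
    jdet_eq_det_quadRep_rpow (expMulL_mem_cone h unit_mem_cone), det_quadRep_expMulL_unit,
    det_quadRep_expMulL_apply, Real.mul_rpow (sq_nonneg _) (det_quadRep_pos hw).le]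

theorem jdet_expMulL_apply_rpow (h : V) {w : V} (hw : w ∈ cone V) (s : ℝ) :
    jdet (expMulL h w) ^ s = jdet (expMulL h (unit V)) ^ s * jdet w ^ s := by
  rw [jdet_expMulL_apply h hw, Real.mul_rpow (jdet_pos (expMulL_mem_cone h unit_mem_cone)).le
    (jdet_pos hw).le]

end SimpleAlgebra

/-! ### The mean value inequality on balanced sets -/

section MeanValue

variable {X F : Type*} [NormedAddCommGroup X]

theorem measurePreserving_smul_of_norm_eq_one [MeasurableSpace X] [BorelSpace X] [ProperSpace X]
    {μ : Measure X} [μ.IsAddHaarMeasure] {𝕜 : Type*} [NormedField 𝕜] [NormedSpace 𝕜 X]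
    {a : 𝕜} (ha : ‖a‖ = 1) : MeasurePreserving (fun x : X => a • x) μ μ := by
  have ha0 : a ≠ 0 := norm_ne_zero_iff.1 (ha ▸ one_ne_zero)
  have hmeas : Measurable fun x : X => a • x := (continuous_const_smul a).measurable
  have : (μ.map fun x : X => a • x).IsAddHaarMeasure :=
    (DistribMulAction.toAddEquiv X (Units.mk0 a ha0)).isAddHaarMeasure_map μ
      (continuous_const_smul a) (continuous_const_smul a⁻¹)
  have hmap := Measure.isAddLeftInvariant_eq_smul (μ.map fun x : X => a • x) μ
  have hpre : (fun x : X => a • x) ⁻¹' Metric.ball 0 1 = Metric.ball 0 1 := by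
    ext x
    simp [norm_smul, ha]
  have hball := congrArg (fun m : Measure X => m (Metric.ball 0 1)) hmap
  simp only [Measure.smul_apply, Measure.map_apply hmeas measurableSet_ball, hpre,
    ENNReal.smul_def, smul_eq_mul] at hball
  refine ⟨hmeas, ?_⟩
  rw [hmap, ENNReal.coe_eq_one.1 ((ENNReal.mul_eq_right
    (Metric.measure_ball_pos μ 0 one_pos).ne' measure_ball_lt_top.ne).1 hball.symm), one_smul]

variable [NormedAddCommGroup F] [NormedSpace ℂ F] [CompleteSpace F]

theorem enorm_center_le_lintegral_circleMap {f : ℂ → F} {c : ℂ} {R : ℝ}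
    (hf : DiffContOnCl ℂ f (Metric.ball c |R|)) :
    ‖f c‖ₑ ≤ ENNReal.ofReal (2 * Real.pi)⁻¹ *
      ∫⁻ θ in Set.Ioc 0 (2 * Real.pi), ‖f (circleMap c R θ)‖ₑ := by
  rw [← hf.circleAverage, Real.circleAverage, intervalIntegral.integral_of_le (by positivity),
    enorm_smul, Real.enorm_eq_ofReal (by positivity)]
  gcongr
  exact enorm_integral_le_lintegral_enorm _

variable [NormedSpace ℂ X] {f : X → F} {U : Set X}

theorem enorm_apply_zero_le_lintegral_circleMap_smul (hU : Balanced ℂ U)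
    (hf : DifferentiableOn ℂ f U) {w : X} (hw : w ∈ U) :
    ‖f 0‖ₑ ≤ ENNReal.ofReal (2 * Real.pi)⁻¹ *
      ∫⁻ θ in Set.Ioc 0 (2 * Real.pi), ‖f (circleMap 0 1 θ • w)‖ₑ := by
  have hd : DiffContOnCl ℂ (fun a : ℂ => f (a • w)) (Metric.ball 0 |1|) := by
    refine DifferentiableOn.diffContOnCl ?_
    rw [abs_one, closure_ball _ one_ne_zero]
    exact hf.comp (by fun_prop) fun a ha => hU.smul_mem (by simpa using ha) hw
  simpa only [zero_smul] using enorm_center_le_lintegral_circleMap hd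

theorem enorm_apply_zero_mul_measure_le [MeasurableSpace X] [BorelSpace X] [ProperSpace X]
    {μ : Measure X} [μ.IsAddHaarMeasure] (hU : IsOpen U) (hbal : Balanced ℂ U)
    (hf : DifferentiableOn ℂ f U) : ‖f 0‖ₑ * μ U ≤ ∫⁻ w in U, ‖f w‖ₑ ∂μ := by
  let g : X → ENNReal := U.indicator fun w => ‖f w‖ₑ
  have hg : Measurable g := by
    classical
    rw [show g = U.piecewise (fun w => ‖f w‖ₑ) 0 from (Set.piecewise_eq_indicator ..).symm]
    exact hf.continuousOn.enorm.measurable_piecewise continuousOn_const hU.measurableSet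
  have hrot : Continuous fun p : X × ℝ => circleMap 0 1 p.2 • p.1 := by fun_prop
  have hpt : ∀ w ∈ U, ‖f 0‖ₑ ≤ ENNReal.ofReal (2 * Real.pi)⁻¹ *
      ∫⁻ θ in Set.Ioc 0 (2 * Real.pi), g (circleMap 0 1 θ • w) := by
    intro w hw
    convert enorm_apply_zero_le_lintegral_circleMap_smul hbal hf hw using 4 with θ
    exact Set.indicator_of_mem (hbal.smul_mem (by simp) hw) _
  calc ‖f 0‖ₑ * μ U
      = ∫⁻ _ in U, ‖f 0‖ₑ ∂μ := by rw [setLIntegral_const]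
    _ ≤ ∫⁻ w in U, (ENNReal.ofReal (2 * Real.pi)⁻¹ *
          ∫⁻ θ in Set.Ioc 0 (2 * Real.pi), g (circleMap 0 1 θ • w)) ∂μ :=
        setLIntegral_mono' hU.measurableSet hpt
    _ = ENNReal.ofReal (2 * Real.pi)⁻¹ *
          ∫⁻ θ in Set.Ioc 0 (2 * Real.pi), (∫⁻ w in U, g (circleMap 0 1 θ • w) ∂μ) := by
        rw [lintegral_const_mul' _ _ ENNReal.ofReal_ne_top, lintegral_lintegral_swap]
        exact (hg.comp hrot.measurable).aemeasurable
    _ ≤ ENNReal.ofReal (2 * Real.pi)⁻¹ * ∫⁻ _ in Set.Ioc 0 (2 * Real.pi), (∫⁻ w, g w ∂μ) := by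
        refine mul_le_mul_right (lintegral_mono fun θ => ?_) _
        refine (setLIntegral_le_lintegral _ _).trans_eq ?_
        exact (measurePreserving_smul_of_norm_eq_one (by simp)).lintegral_comp hg
    _ = ∫⁻ w in U, ‖f w‖ₑ ∂μ := by
        rw [setLIntegral_const, Real.volume_Ioc, sub_zero, mul_left_comm,
          ← ENNReal.ofReal_mul (by positivity), inv_mul_cancel₀ (by positivity),
          ENNReal.ofReal_one, mul_one, lintegral_indicator hU.measurableSet]

end MeanValue

/-! ### Complexifications of Euclidean spaces -/

section Complexification

variable {E : Type*} [NormedAddCommGroup E] [InnerProductSpace ℝ E]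

theorem norm_complex_smul (a : ℂ) (z : ℂ ⊗[ℝ] E) : ‖a • z‖ = ‖a‖ * ‖z‖ := by
  have hrot : ∀ c : Circle, ‖(c : ℂ) • z‖ = ‖z‖ := fun c => by
    have hc : (c : ℂ) • z = LinearIsometry.rTensor E (rotation c).toLinearIsometry z := by
      induction z using TensorProduct.induction_on with
      | zero => simp only [smul_zero, map_zero]
      | tmul b x => simp [TensorProduct.smul_tmul']
      | add z w hz hw => rw [smul_add, hz, hw, map_add]
    rw [hc, LinearIsometry.norm_map]
  have ha : a = (‖a‖ : ℂ) * Circle.exp a.arg := by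
    rw [Circle.coe_exp, Complex.norm_mul_exp_arg_mul_I]
  calc ‖a • z‖ = ‖algebraMap ℝ ℂ ‖a‖ • (Circle.exp a.arg : ℂ) • z‖ := by
        rw [smul_smul, Complex.coe_algebraMap, ← ha]
    _ = ‖a‖ * ‖z‖ := by rw [algebraMap_smul, norm_smul, norm_norm, hrot]

/-- The complex normed space structure on `ℂ ⊗[ℝ] E` extending its real inner product space
structure. It is not an instance, and is only introduced inside proofs, because statements about
`ℂ ⊗[ℝ] E` refer to its `ℂ`-module structure as a tensor product. -/
@[reducible] noncomputable def complexificationNormedSpace : NormedSpace ℂ (ℂ ⊗[ℝ] E) where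
  norm_smul_le a z := (norm_complex_smul a z).le

theorem differentiableOn_complexification_mul {F₁ F₂ : ℂ ⊗[ℝ] E → ℂ} {S : Set (ℂ ⊗[ℝ] E)}
    (h₁ : DifferentiableOn ℂ F₁ S) (h₂ : DifferentiableOn ℂ F₂ S) :
    DifferentiableOn ℂ (fun z => F₁ z * F₂ z) S := by
  let : NormedSpace ℂ (ℂ ⊗[ℝ] E) := complexificationNormedSpace
  exact DifferentiableOn.mul h₁ h₂

variable [FiniteDimensional ℝ E]

variable (E) in
/-- The identification of `E × E` with the complexification of `E`, given by
`(x, y) ↦ x + iy`. -/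
noncomputable def complexEquiv : (E × E) ≃L[ℝ] ℂ ⊗[ℝ] E :=
  ((Complex.equivRealProdLm.rTensor E).trans ((TensorProduct.prodLeft ℝ ℝ ℝ ℝ E).trans
    ((TensorProduct.lid ℝ E).prodCongr (TensorProduct.lid ℝ E)))).symm.toContinuousLinearEquiv

theorem complexEquiv_apply (p : E × E) :
    complexEquiv E p = 1 ⊗ₜ[ℝ] p.1 + Complex.I ⊗ₜ[ℝ] p.2 := by
  rw [← ContinuousLinearEquiv.eq_symm_apply]
  simp [complexEquiv]

theorem complexEquiv_prodMap (g : E →ₗ[ℝ] E) (p : E × E) :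
    complexEquiv E (g.prodMap g p) = g.baseChange ℂ (complexEquiv E p) := by
  simp [complexEquiv_apply]

theorem balanced_complexEquiv_image_prodMap {W : Set (E × E)}
    (hW : Balanced ℂ (complexEquiv E '' W)) (g : E →ₗ[ℝ] E) :
    Balanced ℂ (complexEquiv E '' (g.prodMap g '' W)) := by
  have himage : complexEquiv E '' (g.prodMap g '' W)
      = g.baseChange ℂ '' (complexEquiv E '' W) := by
    simp only [Set.image_image, complexEquiv_prodMap]
  rw [himage, balanced_iff_smul_mem]
  rintro a ha _ ⟨z, hz, rfl⟩
  exact ⟨a • z, hW.smul_mem ha hz, map_smul _ _ _⟩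

variable [MeasurableSpace E] [BorelSpace E]

open Topology in
theorem exists_balanced_complexEquiv_image_subset {S : Set (E × E)} (hS : S ∈ 𝓝 0) :
    ∃ W ⊆ S, IsOpen W ∧ 0 ∈ W ∧ Balanced ℂ (complexEquiv E '' W) ∧
      (volume.prod volume : Measure (E × E)) W ≠ ⊤ := by
  let : NormedSpace ℂ (ℂ ⊗[ℝ] E) := complexificationNormedSpace
  obtain ⟨ρ, hρ, hball⟩ := Metric.mem_nhds_iff.1
    ((complexEquiv E).symm.continuous.continuousAt.preimage_mem_nhds
      (show S ∈ 𝓝 ((complexEquiv E).symm 0) by rwa [map_zero]))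
  refine ⟨complexEquiv E ⁻¹' Metric.ball 0 ρ, fun p hp => ?_,
    Metric.isOpen_ball.preimage (complexEquiv E).continuous, ?_, ?_, ?_⟩
  · simpa using hball hp
  · simpa using hρ
  · rw [Set.image_preimage_eq _ (complexEquiv E).surjective]
    exact balanced_ball_zero
  · rw [← ContinuousLinearEquiv.image_symm_eq_preimage]
    exact (Metric.isBounded_ball.image
      (complexEquiv E).symm.toContinuousLinearMap).measure_lt_top.ne

theorem enorm_sq_mul_volume_le_setLIntegral {F : ℂ ⊗[ℝ] E → ℂ} {W : Set (E × E)} {p : E × E}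
    (hW : IsOpen W) (hbal : Balanced ℂ (complexEquiv E '' W))
    (hF : DifferentiableOn ℂ F (complexEquiv E '' ((p + ·) '' W))) :
    ‖F (complexEquiv E p)‖ₑ ^ 2 * (volume.prod volume : Measure (E × E)) W
      ≤ ∫⁻ q in (p + ·) '' W, ‖F (complexEquiv E q)‖ₑ ^ 2 ∂(volume.prod volume) := by
  let : NormedSpace ℂ (ℂ ⊗[ℝ] E) := complexificationNormedSpace
  borelize (ℂ ⊗[ℝ] E)
  set J := complexEquiv E
  have hJ : MeasurableEmbedding J := J.toHomeomorph.measurableEmbedding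
  have hdiff : DifferentiableOn ℂ (fun w => F (J p + w) ^ 2) (J '' W) := by
    refine DifferentiableOn.pow (hF.comp (by fun_prop) ?_) 2
    rintro _ ⟨q, hq, rfl⟩
    exact ⟨p + q, ⟨q, hq, rfl⟩, map_add J p q⟩
  have hopen : IsOpen (J '' W) := J.toHomeomorph.isOpenMap W hW
  have hmean := enorm_apply_zero_mul_measure_le (μ := (volume.prod volume).map J) hopen hbal hdiff
  rw [hJ.map_apply, hJ.injective.preimage_image, add_zero,
    ← (hJ.measurable.measurePreserving _).setLIntegral_comp_emb hJ] at hmean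
  simpa only [map_add, enorm_pow,
    ← (measurePreserving_add_left (volume.prod volume) p).setLIntegral_comp_emb
      (measurableEmbedding_addLeft p)] using hmean

end Complexification

/-! ### Pointwise bounds in weighted Bergman spaces -/

section Bergman

theorem isOpenMap_prodMap_expMulL (h : V) : IsOpenMap ((expMulL h).prodMap (expMulL h)) := by
  have hinv : expMulL h * expMulL (-h) = 1 := by simpa using expMulL_neg_mul (-h)
  have hsurj : Function.Surjective (expMulL h) := fun x => ⟨_, LinearMap.congr_fun hinv x⟩
  exact LinearMap.isOpenMap_of_finiteDimensional _ (hsurj.prodMap hsurj)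

open Filter Topology in
theorem eventually_mem_cone_and_half_le_jdet_rpow [IsSimpleRing V] (s : ℝ) :
    ∀ᶠ y in 𝓝 (unit V), y ∈ cone V ∧ 1 / 2 ≤ jdet y ^ s := by
  have hcone : cone V ∈ 𝓝 (unit V) := isOpen_cone.mem_nhds unit_mem_cone
  have hlim : Tendsto (fun y : V => jdet y ^ s) (𝓝 (unit V)) (𝓝 1) := by
    have := (continuousOn_jdet.continuousAt hcone).tendsto.rpow_const (p := s)
      (Or.inl (jdet_pos unit_mem_cone).ne')
    rwa [jdet_unit, Real.one_rpow] at this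
  filter_upwards [hcone, hlim.eventually (lt_mem_nhds one_half_lt_one)] with y hy hlt
  exact ⟨hy, hlt.le⟩

variable [MeasurableSpace V] [BorelSpace V]

theorem bergmanNormSq_eq_setLIntegral (ν : ℝ) (F : ℂ ⊗[ℝ] V → ℂ) :
    bergmanNormSq ν F = ∫⁻ p in Set.univ ×ˢ cone V,
      ‖F (complexEquiv V p)‖ₑ ^ 2 * ENNReal.ofReal (jdet p.2 ^ (ν - genus V))
        ∂(volume.prod volume) := by
  simp only [bergmanNormSq, complexEquiv_apply, genus]
  refine lintegral_congr fun p => ?_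
  rw [ENNReal.ofReal_mul (sq_nonneg _), ENNReal.ofReal_pow (norm_nonneg _), ofReal_norm]

theorem setLIntegral_mul_le_bergmanNormSq {ν c : ℝ} {F : ℂ ⊗[ℝ] V → ℂ} {S : Set (V × V)}
    (hS : MeasurableSet S) (hcone : ∀ p ∈ S, p.2 ∈ cone V)
    (hc : ∀ p ∈ S, c ≤ jdet p.2 ^ (ν - genus V)) :
    (∫⁻ p in S, ‖F (complexEquiv V p)‖ₑ ^ 2 ∂(volume.prod volume)) * ENNReal.ofReal c
      ≤ bergmanNormSq ν F := by
  rw [bergmanNormSq_eq_setLIntegral, ← lintegral_mul_const' _ _ ENNReal.ofReal_ne_top]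
  refine (setLIntegral_mono' hS fun p hp => ?_).trans
    (lintegral_mono_set fun p hp => ⟨trivial, hcone p hp⟩)
  gcongr
  exact hc p hp

variable [IsSimpleRing V]

theorem volume_prodMap_expMulL_image (h : V) (W : Set (V × V)) :
    (volume.prod volume : Measure (V × V)) ((expMulL h).prodMap (expMulL h) '' W)
      = ENNReal.ofReal (jdet (expMulL h (unit V)) ^ genus V) * (volume.prod volume) W := by
  rw [Measure.addHaar_image_linearMap, LinearMap.det_prodMap, jdet_expMulL_unit_rpow_genus,
    ← pow_two, abs_of_nonneg (sq_nonneg _)]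

theorem enorm_sq_mul_jdet_rpow_mul_volume_le {ν : ℝ} {W : Set (V × V)} (hW : IsOpen W)
    (hbal : Balanced ℂ (complexEquiv V '' W))
    (hWj : ∀ q ∈ W, unit V + q.2 ∈ cone V ∧ 1 / 2 ≤ jdet (unit V + q.2) ^ (ν - genus V))
    {F : ℂ ⊗[ℝ] V → ℂ} (hF : DifferentiableOn ℂ F (tube V)) {p : V × V} (hp : p.2 ∈ cone V) :
    ‖F (complexEquiv V p)‖ₑ ^ 2 * ENNReal.ofReal (jdet p.2 ^ ν) * (volume.prod volume) W
      ≤ 2 * bergmanNormSq ν F := by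
  obtain ⟨h, hh⟩ := exists_expMulL_unit_eq hp
  set g := (expMulL h).prodMap (expMulL h) with hg
  set S := (p + ·) '' (g '' W)
  have hpos := jdet_pos hp
  have hgopen : IsOpen (g '' W) := isOpenMap_prodMap_expMulL h W hW
  have hSopen : IsOpen S := (Homeomorph.addLeft p).isOpenMap _ hgopen
  have hScone : ∀ q ∈ S,
      q.2 ∈ cone V ∧ jdet p.2 ^ (ν - genus V) / 2 ≤ jdet q.2 ^ (ν - genus V) := by
    rintro _ ⟨_, ⟨q, hq, rfl⟩, rfl⟩
    obtain ⟨hcone, hhalf⟩ := hWj q hq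
    have hsnd : (p + g q).2 = expMulL h (unit V + q.2) := by simp [hg, hh]
    rw [hsnd, jdet_expMulL_apply_rpow h hcone, hh, div_eq_mul_one_div]
    exact ⟨expMulL_mem_cone h hcone,
      mul_le_mul_of_nonneg_left hhalf (Real.rpow_nonneg hpos.le _)⟩
  have hmean := enorm_sq_mul_volume_le_setLIntegral (F := F) (p := p) hgopen
    (balanced_complexEquiv_image_prodMap hbal (expMulL h)) (hF.mono (by
      rintro _ ⟨q, hq, rfl⟩
      exact ⟨q.1, q.2, (hScone q hq).1, complexEquiv_apply q⟩))
  have hweighted := setLIntegral_mul_le_bergmanNormSq (F := F) hSopen.measurableSet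
    (fun q hq => (hScone q hq).1) (fun q hq => (hScone q hq).2)
  have hsplit : ENNReal.ofReal (jdet p.2 ^ ν) = 2 *
      (ENNReal.ofReal (jdet p.2 ^ genus V) * ENNReal.ofReal (jdet p.2 ^ (ν - genus V) / 2)) := by
    rw [← ENNReal.ofReal_mul (by positivity), mul_div_assoc', ← Real.rpow_add hpos,
      add_sub_cancel, ENNReal.ofReal_div_of_pos two_pos, ENNReal.ofReal_ofNat,
      ENNReal.mul_div_cancel two_ne_zero ENNReal.ofNat_ne_top]
  rw [volume_prodMap_expMulL_image, hh] at hmean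
  calc ‖F (complexEquiv V p)‖ₑ ^ 2 * ENNReal.ofReal (jdet p.2 ^ ν) * (volume.prod volume) W
      = 2 * (‖F (complexEquiv V p)‖ₑ ^ 2 * (ENNReal.ofReal (jdet p.2 ^ genus V)
          * (volume.prod volume) W) * ENNReal.ofReal (jdet p.2 ^ (ν - genus V) / 2)) := by
        rw [hsplit]
        ring
    _ ≤ 2 * ((∫⁻ q in S, ‖F (complexEquiv V q)‖ₑ ^ 2 ∂(volume.prod volume))
          * ENNReal.ofReal (jdet p.2 ^ (ν - genus V) / 2)) := by gcongr
    _ ≤ 2 * bergmanNormSq ν F := by gcongr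

theorem exists_enorm_sq_mul_jdet_rpow_le (ν : ℝ) : ∃ C ≠ (⊤ : ENNReal),
    ∀ F : ℂ ⊗[ℝ] V → ℂ, DifferentiableOn ℂ F (tube V) → ∀ p : V × V, p.2 ∈ cone V →
      ‖F (complexEquiv V p)‖ₑ ^ 2 * ENNReal.ofReal (jdet p.2 ^ ν)
        ≤ C * bergmanNormSq ν F := by
  have hcont : Continuous fun q : V × V => unit V + q.2 := by fun_prop
  obtain ⟨W, hWj, hW, hW0, hbal, hWtop⟩ := exists_balanced_complexEquiv_image_subset
    ((hcont.tendsto' 0 (unit V) (by simp)).eventually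
      (eventually_mem_cone_and_half_le_jdet_rpow (ν - genus V)))
  have hWpos : (volume.prod volume : Measure (V × V)) W ≠ 0 := (hW.measure_pos _ ⟨0, hW0⟩).ne'
  refine ⟨2 / (volume.prod volume) W, ENNReal.div_ne_top ENNReal.ofNat_ne_top hWpos,
    fun F hF p hp => ?_⟩
  rw [← ENNReal.mul_div_right_comm, ENNReal.le_div_iff_mul_le (.inl hWpos) (.inl hWtop)]
  exact enorm_sq_mul_jdet_rpow_mul_volume_le hW hbal hWj hF hp

theorem exists_bergmanNormSq_mul_le (ν₁ ν₂ : ℝ) : ∃ C ≠ (⊤ : ENNReal),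
    ∀ F₁ F₂ : ℂ ⊗[ℝ] V → ℂ, MemBergman ν₂ F₂ →
      bergmanNormSq (ν₁ + ν₂) (fun z => F₁ z * F₂ z)
        ≤ C * bergmanNormSq ν₂ F₂ * bergmanNormSq ν₁ F₁ := by
  obtain ⟨C, hC, hbound⟩ := exists_enorm_sq_mul_jdet_rpow_le (V := V) ν₂
  refine ⟨C, hC, fun F₁ F₂ hF₂ => ?_⟩
  have hfin := ENNReal.mul_ne_top hC hF₂.2.ne
  simp only [bergmanNormSq_eq_setLIntegral (F := F₁), bergmanNormSq_eq_setLIntegral (ν₁ + ν₂)]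
  rw [← lintegral_const_mul' _ _ hfin]
  refine setLIntegral_mono' (MeasurableSet.univ.prod isOpen_cone.measurableSet) ?_
  rintro p ⟨-, hp⟩
  calc ‖F₁ (complexEquiv V p) * F₂ (complexEquiv V p)‖ₑ ^ 2
        * ENNReal.ofReal (jdet p.2 ^ (ν₁ + ν₂ - genus V))
      = ‖F₂ (complexEquiv V p)‖ₑ ^ 2 * ENNReal.ofReal (jdet p.2 ^ ν₂) *
          (‖F₁ (complexEquiv V p)‖ₑ ^ 2 * ENNReal.ofReal (jdet p.2 ^ (ν₁ - genus V))) := by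
        rw [show ν₁ + ν₂ - genus V = ν₂ + (ν₁ - genus V) by ring, Real.rpow_add (jdet_pos hp),
          ENNReal.ofReal_mul (Real.rpow_nonneg (jdet_pos hp).le _), enorm_mul]
        ring
    _ ≤ C * bergmanNormSq ν₂ F₂ *
          (‖F₁ (complexEquiv V p)‖ₑ ^ 2 * ENNReal.ofReal (jdet p.2 ^ (ν₁ - genus V))) :=
        mul_le_mul_left (hbound F₂ hF₂.1 p hp) _

end Bergman

end EJA

theorem mainTheorem1_general {V : Type*} [NonUnitalNonAssocCommRing V] [Module ℝ V]
    [IsScalarTower ℝ V V] [SMulCommClass ℝ V V] [EJA.EuclideanJordanAlgebra V]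
    [IsSimpleRing V] [MeasurableSpace V] [BorelSpace V] (ν₁ ν₂ : ℝ)
    (F₁ F₂ : ℂ ⊗[ℝ] V → ℂ) (hF₁ : EJA.MemBergman ν₁ F₁) (hF₂ : EJA.MemBergman ν₂ F₂) :
    EJA.MemBergman (ν₁ + ν₂) (fun z => F₁ z * F₂ z) := by
  obtain ⟨C, hC, hmul⟩ := EJA.exists_bergmanNormSq_mul_le (V := V) ν₁ ν₂
  exact ⟨EJA.differentiableOn_complexification_mul hF₁.1 hF₂.1, (hmul F₁ F₂ hF₂).trans_lt
    (ENNReal.mul_lt_top (ENNReal.mul_lt_top hC.lt_top hF₂.2) hF₁.2)⟩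

theorem mainTheorem1 {V : Type*} [NonUnitalNonAssocCommRing V] [Module ℝ V]
    [IsScalarTower ℝ V V] [SMulCommClass ℝ V V] [EJA.EuclideanJordanAlgebra V]
    [IsSimpleRing V] [MeasurableSpace V] [BorelSpace V] (ν₁ ν₂ : ℝ)
    (hν₁ : 2 * (Module.finrank ℝ V : ℝ) / (EJA.rank V : ℝ) - 1 < ν₁)
    (hν₂ : 2 * (Module.finrank ℝ V : ℝ) / (EJA.rank V : ℝ) - 1 < ν₂)
    (F₁ F₂ : ℂ ⊗[ℝ] V → ℂ) (hF₁ : EJA.MemBergman ν₁ F₁) (hF₂ : EJA.MemBergman ν₂ F₂) :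
    EJA.MemBergman (ν₁ + ν₂) (fun z => F₁ z * F₂ z) :=
  mainTheorem1_general ν₁ ν₂ F₁ F₂ hF₁ hF₂
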